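/- For a finite field $K$ and a divisor $r$ of $|K|-1$, call $\xi\in K^*$ $r$-primitive if its multiplicative order is $(|K|-1)/r$. Let $\mathcal{E}_2$ be the following set of 101 odd prime powers: $$\{3, 5, 7, 9, 11, 13, 17, 19, 23, 25, 27, 29, 31, 37, 41, 43, 47, 49, 53, 59, 61, 67, 71, 73, 79, 81, 83, 89, 97, 101, 103, 109, 113, 121, 125, 127, 131, 137, 139, 149, 151, 157, 169, 173, 181, 191, 197, 199, 211, 229, 239, 241, 269, 281, 307, 311, 331, 337, 349, 361, 373, 379, 389, 409, 419, 421, 461, 463, 509, 521, 529, 569, 571, 601, 617, 631, 659, 661, 701, 761, 769, 841, 859, 881, 911, 1009, 1021, 1231, 1289, 1301, 1331, 1429, 1609, 1741, 1849, 1861, 2029, 2281, 2311, 2729, 3541\}.$$ **Theorem.** Let $q$ be an odd prime power with $q\notin\mathcal{E}_2$, and let $\beta\in\mathbb{F}_q^*$. Then there exists a 2-primitive element $\xi\in\mathbb{F}_{q^2}$, that is, an element of multiplicative order $(q^2-1)/2$, such that $\operatorname{Tr}(\xi)=\beta$, where $\operatorname{Tr}:\mathbb{F}_{q^2}\to\mathbb{F}_q$,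 $\operatorname{Tr}(\xi)=\xi+\xi^q$, is the trace. -/

import Mathlib

/-- An element `ξ` of a finite field `K` is `r`-primitive, for a divisor `r` of `|K| - 1`, if it is
nonzero and has multiplicative order `(|K| - 1) / r`. -/
def IsRPrimitive {K : Type*} [Field K] [Finite K] (r : ℕ) (ξ : K) : Prop :=
  r ∣ Nat.card K - 1 ∧ ξ ≠ 0 ∧ orderOf ξ = (Nat.card K - 1) / r

/-- The list of the `101` excluded odd prime powers. -/
def exceptionalOrders : Finset ℕ :=
  {
    3, 5, 7, 9, 11, 13, 17, 19, 23, 25, 27, 29, 31, 37, 41, 43, 47, 49, 53, 59, 61, 67, 71,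
    73, 79, 81, 83, 89, 97, 101, 103, 109, 113, 121, 125, 127, 131, 137, 139, 149, 151,
    157, 169, 173, 181, 191, 197, 199, 211, 229, 239, 241, 269, 281, 307, 311, 331, 337,
    349, 361, 373, 379, 389, 409, 419, 421, 461, 463, 509, 521, 529, 569, 571, 601, 617,
    631, 659, 661, 701, 761, 769, 841, 859, 881, 911, 1009, 1021, 1231, 1289, 1301, 1331,
    1429, 1609, 1741, 1849, 1861, 2029, 2281, 2311, 2729, 3541}

/-!
# Elements of order `(q ^ 2 - 1) / 2` with prescribed trace

Fix a character `X` of `E` of order `q ^ 2 - 1`. An element `ξ` has order `(q ^ 2 - 1) / 2` as soon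
as the quartic character `X ^ ((q ^ 2 - 1) / 4)` takes the value `-1` at `ξ` and no character
`X ^ ((q ^ 2 - 1) / ℓ)` with `ℓ` an odd prime takes the value `1`
(`orderOf_eq_half_of_characters`). The elements of trace `β` with these properties are counted by
character sums over the fibre of the trace.

For a nontrivial character `χ` the second moment of its sums over all the fibres of the trace is
`q ^ 2 - q` (`sum_norm_traceSum_sq`). The sums over the fibres of nonzero elements have equal
absolute values, so each is at most `√q`; and if `χ` is trivial on `F`, the fibre of `0` takes up
nearly all of the second moment and the others are at most `1`. The characters trivial on `F` are
those with `χ ^ (q + 1) = 1`; in particular those of odd prime order `ℓ ∣ q + 1` are.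

The conditions at a set `C` of primes are imposed by weights whose expansion in characters is
explicit (`primeWeight`, `quarticWeight`), and the error is controlled by induction on `C`
(`twistedBound_prod`). The remaining primes `R` are sieved: an element of the support that fails at
some `ℓ ∈ R` is counted in the sum over `ℓ` of the weight on the `ℓ`-th powers, whose main term is
the fraction `∑ 1 / ℓ` of the total (`TwistedBound.exists_ne_zero`). This gives the numerical
condition `SieveCriterion q`, in which only the prime factors of `q ^ 2 - 1` enter.

For `q ≥ 15003` the criterion always holds (`sieveCriterion_of_le`). With `t` odd primes dividing
`q ^ 2 - 1`, no sieving is needed for `t ≤ 4`, nor for `t ≥ 16`, since `8` times the product of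
the primes is less than `q ^ 2`; in between, the smallest prime is kept and the others are sieved,
their reciprocals being bounded by those of the first primes. For `q < 15003` the criterion is
evaluated for each odd `q` by a verified test (`smallTest_eq_true`), with `C` empty or `C ⊆ {3}`;
it fails exactly at the listed exceptions and at some numbers that are not prime powers.
-/

/-! ### Character sums over the fibres of the trace -/

section TraceSums

open Finset

variable {F E : Type*} [Field F] [Field E] [Fintype E] [Algebra F E]

/-- The sum of `f` over the elements of `E` of trace `t` over `F`. -/
noncomputable def traceSum [DecidableEq F] (t : F) (f : E → ℂ) : ℂ :=
  ∑ ξ : E with Algebra.trace F E ξ = t, f ξ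

theorem MulChar.norm_apply_eq_one (χ : MulChar E ℂ) {x : E} (hx : x ≠ 0) : ‖χ x‖ = 1 := by
  have h : (χ x) ^ (Fintype.card E - 1) = 1 := by
    rw [← map_pow, FiniteField.pow_card_sub_one_eq_one x hx, map_one]
  exact Complex.norm_eq_one_of_pow_eq_one h (by have := Fintype.one_lt_card (α := E); omega)

/-- In the cyclic group of units, of order `a * b`, the `b`-torsion consists of `a`-th powers. -/
theorem exists_pow_eq_of_pow_eq_one {a b : ℕ} (hab : Fintype.card E - 1 = a * b) (hb : b ≠ 0)
    {y : E} (hy : y ^ b = 1) : ∃ z : E, z ≠ 0 ∧ y = z ^ a := by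
  classical
  have hy0 : y ≠ 0 := by rintro rfl; simp [hb] at hy
  obtain ⟨g, hg⟩ := IsCyclic.exists_generator (α := Eˣ)
  have ho : orderOf g = Fintype.card E - 1 := by
    rw [orderOf_eq_card_of_forall_mem_zpowers hg, Nat.card_eq_fintype_card, Fintype.card_units]
  obtain ⟨k, hk⟩ := mem_powers_iff_mem_zpowers.2 (hg (Units.mk0 y hy0))
  have hk' : g ^ k = Units.mk0 y hy0 := hk
  have h1 : g ^ (k * b) = 1 := by
    rw [pow_mul, hk']; ext; simpa using hy
  have h2 := orderOf_dvd_of_pow_eq_one h1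
  rw [ho, hab] at h2
  obtain ⟨c, rfl⟩ := Nat.dvd_of_mul_dvd_mul_right (Nat.pos_of_ne_zero hb) h2
  refine ⟨(g ^ c : Eˣ), Units.ne_zero _, ?_⟩
  have := congrArg Units.val hk'
  simp only [Units.val_mk0] at this
  rw [← this, mul_comm, pow_mul]
  simp

theorem finrank_eq_two [Fintype F] (hE : Fintype.card E = Fintype.card F ^ 2) :
    Module.finrank F E = 2 := by
  have h := Module.card_eq_pow_finrank (K := F) (V := E)
  rw [hE] at h
  exact (Nat.pow_right_injective (Fintype.one_lt_card (α := F)) h).symm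

section

variable [DecidableEq F]

theorem traceSum_mulChar_mul (χ : MulChar E ℂ) {c : F} (hc : c ≠ 0) (t : F) :
    traceSum (c * t) (fun ξ ↦ χ ξ) = χ (algebraMap F E c) * traceSum t (fun ξ ↦ χ ξ) := by
  have hc' : algebraMap F E c ≠ 0 := by simpa using hc
  unfold traceSum
  rw [mul_sum]
  symm
  refine sum_bij' (fun ξ _ ↦ algebraMap F E c * ξ) (fun ξ _ ↦ (algebraMap F E c)⁻¹ * ξ)
    ?_ ?_ ?_ ?_ ?_
  · intro ξ hξ
    simp only [mem_filter, mem_univ, true_and] at hξ ⊢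
    rw [← Algebra.smul_def, map_smul, hξ, smul_eq_mul]
  · intro ξ hξ
    simp only [mem_filter, mem_univ, true_and] at hξ ⊢
    rw [← map_inv₀, ← Algebra.smul_def, map_smul, hξ, smul_eq_mul, inv_mul_cancel_left₀ hc]
  · intro ξ _
    simp [hc]
  · intro ξ _
    simp [hc]
  · intro ξ _
    rw [map_mul]

theorem norm_traceSum_eq (χ : MulChar E ℂ) {s t : F} (hs : s ≠ 0) (ht : t ≠ 0) :
    ‖traceSum s (fun ξ ↦ χ ξ)‖ = ‖traceSum t (fun ξ ↦ χ ξ)‖ := by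
  have h := traceSum_mulChar_mul χ (div_ne_zero hs ht) t
  rw [div_mul_cancel₀ _ ht] at h
  rw [h, norm_mul, χ.norm_apply_eq_one (by simp [hs, ht]), one_mul]

variable [Fintype F]

theorem card_mul_card_trace_fiber (t : F) :
    Fintype.card F * #{ξ : E | Algebra.trace F E ξ = t} = Fintype.card E := by
  have hs := Algebra.trace_surjective F E
  have h : ∀ s : F, #{ξ : E | Algebra.trace F E ξ = s} = #{ξ : E | Algebra.trace F E ξ = t} :=
    fun s ↦ AddMonoidHom.card_fiber_eq_of_mem_range (Algebra.trace F E).toAddMonoidHom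
      (hs s) (hs t)
  have := card_eq_sum_card_fiberwise (s := (univ : Finset E)) (t := (univ : Finset F))
    (f := fun ξ ↦ Algebra.trace F E ξ) (fun _ _ ↦ by simp)
  rw [card_univ] at this
  rw [this, sum_congr rfl (fun s _ ↦ h s)]
  simp

theorem card_trace_fiber (hE : Fintype.card E = Fintype.card F ^ 2) (t : F) :
    #{ξ : E | Algebra.trace F E ξ = t} = Fintype.card F := by
  have h := card_mul_card_trace_fiber (E := E) t
  rw [hE, sq] at h
  exact Nat.eq_of_mul_eq_mul_left Fintype.card_pos h

theorem traceSum_const_one (hE : Fintype.card E = Fintype.card F ^ 2) (t : F) :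
    traceSum t (fun _ : E ↦ (1 : ℂ)) = Fintype.card F := by
  simp [traceSum, card_trace_fiber hE t]

theorem card_trace_mul_eq_zero (hE : Fintype.card E = Fintype.card F ^ 2) {c : E} (hc : c ≠ 0) :
    #{y : E | Algebra.trace F E (c * y) = 0} = Fintype.card F := by
  rw [← card_trace_fiber hE (0 : F)]
  refine card_bij' (fun y _ ↦ c * y) (fun y _ ↦ c⁻¹ * y) ?_ ?_ ?_ ?_ <;> simp [hc]

/-- The second moment of a nontrivial character over the fibres of the trace. After the
substitution `x = ρ * y` the pairs `(x, y)` of equal trace and ratio `ρ` are the nonzero `y` with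
`ρ * y - y` of trace zero, and their number takes the same value for all `ρ ≠ 1`. -/
theorem sum_norm_traceSum_sq (hE : Fintype.card E = Fintype.card F ^ 2) {χ : MulChar E ℂ}
    (hχ : χ ≠ 1) :
    ∑ t : F, ‖traceSum t (fun ξ ↦ χ ξ)‖ ^ 2 =
      (Fintype.card F : ℝ) ^ 2 - Fintype.card F := by
  classical
  set q := Fintype.card F with hq
  have hcount : ∀ ρ : E, (#{y : E | y ≠ 0 ∧ Algebra.trace F E ((ρ - 1) * y) = 0} : ℂ) =
      ((q : ℂ) - 1) + if ρ = 1 then (q : ℂ) ^ 2 - q else 0 := by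
    intro ρ
    have h1 : ({y : E | y ≠ 0 ∧ Algebra.trace F E ((ρ - 1) * y) = 0} : Finset E) =
        ({y : E | Algebra.trace F E ((ρ - 1) * y) = 0} : Finset E).erase 0 := by
      ext y; simp
    have h0 : (0 : E) ∈ ({y : E | Algebra.trace F E ((ρ - 1) * y) = 0} : Finset E) := by simp
    rw [h1, card_erase_of_mem h0, Nat.cast_sub (card_pos.2 ⟨0, h0⟩)]
    by_cases h : ρ = 1
    · subst h
      simp [hE, hq]
    · rw [card_trace_mul_eq_zero hE (sub_ne_zero.2 h)]
      simp [h, hq]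
  have key : (∑ t : F, (traceSum t (fun ξ ↦ χ ξ)) * (starRingEnd ℂ) (traceSum t (fun ξ ↦ χ ξ))) =
      (q : ℂ) ^ 2 - q := by
    calc _ = ∑ t : F, ∑ y : E with Algebra.trace F E y = t,
            ∑ x : E with Algebra.trace F E x = t, χ x * χ⁻¹ y := by
          refine sum_congr rfl fun t _ ↦ ?_
          unfold traceSum
          rw [map_sum, mul_sum]
          refine sum_congr rfl fun y _ ↦ ?_
          rw [sum_mul]
          refine sum_congr rfl fun x _ ↦ ?_
          rw [← MulChar.star_apply' χ y]
          rfl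
      _ = ∑ y : E, ∑ x : E with Algebra.trace F E x = Algebra.trace F E y, χ x * χ⁻¹ y := by
          rw [← sum_fiberwise (s := (univ : Finset E)) (g := fun y ↦ Algebra.trace F E y)]
          refine sum_congr rfl fun t _ ↦ sum_congr rfl fun y hy ↦ ?_
          rw [(mem_filter.1 hy).2]
      _ = ∑ y : E, ∑ ρ : E,
            if y ≠ 0 ∧ Algebra.trace F E ((ρ - 1) * y) = 0 then χ ρ else 0 := by
          refine sum_congr rfl fun y _ ↦ ?_
          by_cases hy : y = 0
          · subst hy
            have h0 : χ⁻¹ (0 : E) = 0 := MulChar.map_zero _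
            simp [h0]
          · rw [sum_filter, ← Equiv.sum_comp (Equiv.mulRight₀ y hy)]
            refine sum_congr rfl fun ρ _ ↦ ?_
            change (if Algebra.trace F E (ρ * y) = _ then χ (ρ * y) * χ⁻¹ y else 0) = _
            have h1 : χ (ρ * y) * χ⁻¹ y = χ ρ := by
              rw [map_mul, mul_assoc, ← MulChar.mul_apply, mul_inv_cancel,
                MulChar.one_apply (IsUnit.mk0 y hy), mul_one]
            simp only [h1, sub_mul, one_mul, map_sub, sub_eq_zero, ne_eq, hy,
              not_false_eq_true, true_and]
      _ = ∑ ρ : E, χ ρ * (((q : ℂ) - 1) + if ρ = 1 then (q : ℂ) ^ 2 - q else 0) := by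
          rw [sum_comm]
          refine sum_congr rfl fun ρ _ ↦ ?_
          rw [← hcount, ← sum_filter, sum_const, nsmul_eq_mul, mul_comm]
      _ = (q : ℂ) ^ 2 - q := by
          simp only [mul_add, sum_add_distrib, ← sum_mul, MulChar.sum_eq_zero_of_ne_one hχ]
          simp
  have h2 : ((∑ t : F, ‖traceSum t (fun ξ ↦ χ ξ)‖ ^ 2 : ℝ) : ℂ) = ((q : ℝ) ^ 2 - q : ℝ) := by
    push_cast
    rw [← key]
    refine sum_congr rfl fun t _ ↦ ?_
    rw [Complex.mul_conj']
  exact_mod_cast h2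

/-- The second moment with the fibre of `0` separated: the other fibres contribute equally. -/
theorem card_sub_one_mul_norm_traceSum_sq (hE : Fintype.card E = Fintype.card F ^ 2)
    {χ : MulChar E ℂ} (hχ : χ ≠ 1) {t : F} (ht : t ≠ 0) :
    ((Fintype.card F : ℝ) - 1) * ‖traceSum t (fun ξ ↦ χ ξ)‖ ^ 2 =
      (Fintype.card F : ℝ) ^ 2 - Fintype.card F - ‖traceSum (0 : F) (fun ξ ↦ χ ξ)‖ ^ 2 := by
  have h := sum_norm_traceSum_sq hE hχ
  rw [← add_sum_erase _ _ (mem_univ (0 : F)), sum_congr rfl (g := fun _ ↦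
    ‖traceSum t (fun ξ ↦ χ ξ)‖ ^ 2) (fun s hs ↦ by
      rw [norm_traceSum_eq χ (ne_of_mem_erase hs) ht]), sum_const, card_erase_of_mem (mem_univ _),
      nsmul_eq_mul, card_univ, Nat.cast_sub Fintype.card_pos] at h
  push_cast at h
  linarith

/-- For every nontrivial character, the sum over a fibre of the trace is at most `√q`. -/
theorem norm_traceSum_le_sqrt (hE : Fintype.card E = Fintype.card F ^ 2)
    {χ : MulChar E ℂ} (hχ : χ ≠ 1) {t : F} (ht : t ≠ 0) :
    ‖traceSum t (fun ξ ↦ χ ξ)‖ ≤ √(Fintype.card F) := by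
  have h := card_sub_one_mul_norm_traceSum_sq hE hχ ht
  have hq : (1 : ℝ) < Fintype.card F := by exact_mod_cast Fintype.one_lt_card (α := F)
  refine Real.le_sqrt_of_sq_le ?_
  have h0 := sq_nonneg ‖traceSum (0 : F) (fun ξ ↦ χ ξ)‖
  have : ((Fintype.card F : ℝ) - 1) * ‖traceSum t (fun ξ ↦ χ ξ)‖ ^ 2 ≤
      ((Fintype.card F : ℝ) - 1) * Fintype.card F := by nlinarith
  exact le_of_mul_le_mul_left this (by linarith)

/-- A character that is trivial on `F` is constant on the nonzero elements of trace zero, as these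
form one coset of the units of `F`; this leaves only a sum of size `1` for the other fibres. -/
theorem norm_traceSum_le_one (hE : Fintype.card E = Fintype.card F ^ 2)
    {χ : MulChar E ℂ} (hχ : χ ≠ 1) (hχF : χ ^ (Fintype.card F + 1) = 1) {t : F} (ht : t ≠ 0) :
    ‖traceSum t (fun ξ ↦ χ ξ)‖ ≤ 1 := by
  classical
  have hq1 := Fintype.one_lt_card (α := F)
  have htr : ∀ x : E, x ≠ 0 → Algebra.trace F E x = 0 → x ^ (Fintype.card F - 1) = -1 := by
    intro x hx h
    have h1 := FiniteField.algebraMap_trace_eq_sum_pow F E x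
    rw [finrank_eq_two hE, h, map_zero, Nat.card_eq_fintype_card] at h1
    simp only [sum_range_succ, range_zero, sum_empty, pow_zero, pow_one, zero_add] at h1
    have h2 : x * (x ^ (Fintype.card F - 1) + 1) = 0 := by
      rw [mul_add, mul_one, ← pow_succ', Nat.sub_add_cancel hq1.le, add_comm, ← h1]
    rcases mul_eq_zero.1 h2 with h3 | h3
    · exact absurd h3 hx
    · exact eq_neg_of_add_eq_zero_left h3
  have hcard := card_trace_fiber (E := E) hE (0 : F)
  obtain ⟨θ, hθ, hθ0⟩ : ∃ θ ∈ ({ξ : E | Algebra.trace F E ξ = 0} : Finset E), θ ≠ 0 :=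
    exists_mem_ne (by omega) 0
  simp only [mem_filter, mem_univ, true_and] at hθ
  have hconst : ∀ x : E, x ≠ 0 → Algebra.trace F E x = 0 → χ x = χ θ := by
    intro x hx h
    have h1 : (x / θ) ^ (Fintype.card F - 1) = 1 := by
      rw [div_pow, htr x hx h, htr θ hθ0 hθ, div_self (by simp)]
    obtain ⟨z, hz, h2⟩ := exists_pow_eq_of_pow_eq_one (a := Fintype.card F + 1)
      (by rw [hE, ← Nat.sq_sub_sq, one_pow]) (by omega) h1
    have h3 : χ (x / θ) = 1 := by
      rw [h2, map_pow, ← MulChar.pow_apply' _ (by omega), hχF, MulChar.one_apply (IsUnit.mk0 z hz)]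
    rw [← div_mul_cancel₀ x hθ0, map_mul, h3, one_mul]
  have hS0 : traceSum (0 : F) (fun ξ ↦ χ ξ) = ((Fintype.card F : ℂ) - 1) * χ θ := by
    have h0 : (0 : E) ∈ ({ξ : E | Algebra.trace F E ξ = 0} : Finset E) := by simp
    unfold traceSum
    rw [← add_sum_erase _ _ h0, MulChar.map_zero, zero_add, sum_congr rfl (g := fun _ ↦ χ θ),
      sum_const, card_erase_of_mem h0, hcard, nsmul_eq_mul, Nat.cast_sub hq1.le, Nat.cast_one]
    intro x hx
    exact hconst x (ne_of_mem_erase hx) (mem_filter.1 (mem_of_mem_erase hx)).2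
  have hq : (1 : ℝ) < Fintype.card F := by exact_mod_cast hq1
  have hn0 : ‖traceSum (0 : F) (fun ξ ↦ χ ξ)‖ = (Fintype.card F : ℝ) - 1 := by
    rw [hS0, norm_mul, χ.norm_apply_eq_one hθ0, mul_one]
    rw [← Complex.ofReal_natCast, ← Complex.ofReal_one, ← Complex.ofReal_sub, Complex.norm_real,
      Real.norm_of_nonneg (by linarith)]
  have h := card_sub_one_mul_norm_traceSum_sq hE hχ ht
  rw [hn0] at h
  have h1 : ((Fintype.card F : ℝ) - 1) * ‖traceSum t (fun ξ ↦ χ ξ)‖ ^ 2 =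
      ((Fintype.card F : ℝ) - 1) * 1 := by rw [h]; ring
  have h2 := mul_left_cancel₀ (by linarith) h1
  nlinarith [norm_nonneg (traceSum t (fun ξ ↦ χ ξ))]

end

end TraceSums

/-! ### Weights and the sieve inequality -/

section Sieve

open Finset

variable {E : Type*} [Field E]

/-- The weight attached to a prime `ℓ` and a character `ψ` of order `ℓ`: it vanishes where `ψ` is
`1`, and its value elsewhere makes its trivial Fourier coefficient equal to `1`. -/
noncomputable def primeWeight (ψ : MulChar E ℂ) (ℓ : ℕ) (ξ : E) : ℝ :=
  open Classical in if ψ ξ = 1 then 0 else (ℓ : ℝ) / (ℓ - 1)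

theorem primeWeight_nonneg (ψ : MulChar E ℂ) {ℓ : ℕ} (hℓ : 1 < ℓ) (ξ : E) :
    0 ≤ primeWeight ψ ℓ ξ := by
  have : (1 : ℝ) < ℓ := by exact_mod_cast hℓ
  unfold primeWeight
  split_ifs
  · exact le_rfl
  · exact div_nonneg (by linarith) (by linarith)

theorem primeWeight_eq_sum {ψ : MulChar E ℂ} {ℓ : ℕ} (hℓ : 1 < ℓ) (hψ : ψ ^ ℓ = 1) {ξ : E}
    (hξ : ξ ≠ 0) :
    (primeWeight ψ ℓ ξ : ℂ) = 1 - ((ℓ : ℂ) - 1)⁻¹ * ∑ j ∈ Ico 1 ℓ, (ψ ^ j) ξ := by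
  have hℓ' : (ℓ : ℂ) - 1 ≠ 0 := by
    rw [sub_ne_zero]; exact_mod_cast hℓ.ne'
  have h1 : ∀ j ∈ Ico 1 ℓ, (ψ ^ j) ξ = (ψ ξ) ^ j := fun j hj ↦
    MulChar.pow_apply' _ (by have := (mem_Ico.1 hj).1; omega) _
  have h2 : (ψ ξ) ^ ℓ = 1 := by
    rw [← MulChar.pow_apply' _ (by omega), hψ, MulChar.one_apply (IsUnit.mk0 ξ hξ)]
  rw [sum_congr rfl h1]
  unfold primeWeight
  split_ifs with h
  · simp only [h, one_pow, sum_const, Nat.card_Ico, nsmul_eq_mul, mul_one]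
    rw [Nat.cast_sub hℓ.le, Nat.cast_one, inv_mul_cancel₀ hℓ']
    simp
  · have h3 : ∑ j ∈ Ico 1 ℓ, (ψ ξ) ^ j = -1 := by
      have h4 := geom_sum_eq h ℓ
      rw [h2, sub_self, zero_div, range_eq_Ico, sum_eq_sum_Ico_succ_bot (by omega)] at h4
      rw [pow_zero, zero_add] at h4
      exact (neg_eq_of_add_eq_zero_right h4).symm
    rw [h3]
    push_cast
    field_simp
    ring

/-- The weight `4` on the elements where a character of order `4` takes the value `-1`. -/
noncomputable def quarticWeight (ψ : MulChar E ℂ) (ξ : E) : ℝ :=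
  open Classical in if ψ ξ = -1 then 4 else 0

theorem quarticWeight_eq {ψ : MulChar E ℂ} (hψ : ψ ^ 4 = 1) {ξ : E} (hξ : ξ ≠ 0) :
    (quarticWeight ψ ξ : ℂ) = 1 - (ψ ^ 1) ξ + (ψ ^ 2) ξ - (ψ ^ 3) ξ := by
  have h2 : (ψ ξ) ^ 4 = 1 := by
    rw [← MulChar.pow_apply' _ (by omega), hψ, MulChar.one_apply (IsUnit.mk0 ξ hξ)]
  rw [MulChar.pow_apply' _ (by omega), MulChar.pow_apply' _ (by omega),
    MulChar.pow_apply' _ (by omega)]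
  unfold quarticWeight
  split_ifs with h
  · rw [h]; norm_num
  · have h3 : (ψ ξ + 1) * (1 - (ψ ξ) ^ 1 + (ψ ξ) ^ 2 - (ψ ξ) ^ 3) = 0 := by
      linear_combination -h2
    rcases mul_eq_zero.1 h3 with h4 | h4
    · exact absurd (eq_neg_of_add_eq_zero_left h4) h
    · rw [h4]; simp

/-- Coprimality of orders keeps the twisted characters nontrivial: the `m`-th power kills `χ` but
not `ψ ^ j`. -/
theorem pow_mul_ne_one_of_coprime {ψ χ : MulChar E ℂ} {ℓ m j : ℕ} (hψ : orderOf ψ = ℓ)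
    (hm : m.Coprime ℓ) (hχ : χ ^ m = 1) (hj : ¬ ℓ ∣ j) : ψ ^ j * χ ≠ 1 := by
  intro h
  have h1 : ψ ^ (j * m) = 1 := by
    have := congrArg (· ^ m) h
    simpa only [mul_pow, hχ, mul_one, one_pow, ← pow_mul] using this
  have h2 := orderOf_dvd_of_pow_eq_one h1
  rw [hψ] at h2
  exact hj (hm.symm.dvd_of_dvd_mul_right h2)

variable {F : Type*} [Field F] [Fintype E] [Algebra F E] [DecidableEq F]

theorem traceSum_congr {t : F} (ht : t ≠ 0) {f g : E → ℂ} (h : ∀ ξ, ξ ≠ 0 → f ξ = g ξ) :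
    traceSum t f = traceSum t g := by
  refine sum_congr rfl fun ξ hξ ↦ h ξ ?_
  rintro rfl
  simp only [map_zero, mem_filter, mem_univ, true_and] at hξ
  exact ht hξ.symm

/-- Multiplication by a prime weight changes the sum by an average of `ℓ - 1` twists. -/
theorem norm_traceSum_mul_primeWeight_sub_le {t : F} (ht : t ≠ 0) (f : E → ℝ) {ψ χ : MulChar E ℂ}
    {ℓ : ℕ} (hℓ : 1 < ℓ) (hψ : ψ ^ ℓ = 1) {B : ℝ}
    (hB : ∀ j ∈ Ico 1 ℓ, ‖traceSum t (fun ξ ↦ f ξ * (ψ ^ j * χ) ξ)‖ ≤ B) :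
    ‖traceSum t (fun ξ ↦ ((f ξ * primeWeight ψ ℓ ξ : ℝ) : ℂ) * χ ξ) -
      traceSum t (fun ξ ↦ f ξ * χ ξ)‖ ≤ B := by
  have hℓ' : (0 : ℝ) < (ℓ : ℝ) - 1 := by
    rw [sub_pos]; exact_mod_cast hℓ
  have h1 : traceSum t (fun ξ ↦ ((f ξ * primeWeight ψ ℓ ξ : ℝ) : ℂ) * χ ξ) =
      traceSum t (fun ξ ↦ f ξ * χ ξ) -
        ((ℓ : ℂ) - 1)⁻¹ * ∑ j ∈ Ico 1 ℓ, traceSum t (fun ξ ↦ f ξ * (ψ ^ j * χ) ξ) := by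
    have h2 : traceSum t (fun ξ ↦ ((f ξ * primeWeight ψ ℓ ξ : ℝ) : ℂ) * χ ξ) =
        traceSum t (fun ξ ↦ f ξ * χ ξ -
          ((ℓ : ℂ) - 1)⁻¹ * ∑ j ∈ Ico 1 ℓ, f ξ * (ψ ^ j * χ) ξ) := by
      refine traceSum_congr ht fun ξ hξ ↦ ?_
      rw [Complex.ofReal_mul, primeWeight_eq_sum hℓ hψ hξ]
      simp only [MulChar.mul_apply, ← mul_sum, ← sum_mul]
      ring
    rw [h2]
    unfold traceSum
    rw [sum_sub_distrib, ← mul_sum, sum_comm]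
  have hn : ‖((ℓ : ℂ) - 1)⁻¹‖ = ((ℓ : ℝ) - 1)⁻¹ := by
    rw [norm_inv]
    congr 1
    rw [← Complex.ofReal_natCast, ← Complex.ofReal_one, ← Complex.ofReal_sub, Complex.norm_real,
      Real.norm_of_nonneg hℓ'.le]
  rw [h1, sub_sub_cancel_left, norm_neg, norm_mul, hn, inv_mul_le_iff₀ hℓ']
  refine (norm_sum_le_of_le _ hB).trans_eq ?_
  rw [sum_const, Nat.card_Ico, nsmul_eq_mul, Nat.cast_sub hℓ.le, Nat.cast_one]

theorem traceSum_quarticWeight_mul {t : F} (ht : t ≠ 0) {ψ : MulChar E ℂ} (hψ : ψ ^ 4 = 1)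
    (χ : MulChar E ℂ) :
    traceSum t (fun ξ ↦ (quarticWeight ψ ξ : ℂ) * χ ξ) = traceSum t (fun ξ ↦ χ ξ) -
      traceSum t (fun ξ ↦ (ψ ^ 1 * χ) ξ) + traceSum t (fun ξ ↦ (ψ ^ 2 * χ) ξ) -
      traceSum t (fun ξ ↦ (ψ ^ 3 * χ) ξ) := by
  rw [traceSum_congr ht (g := fun ξ ↦ χ ξ - (ψ ^ 1 * χ) ξ + (ψ ^ 2 * χ) ξ - (ψ ^ 3 * χ) ξ)]
  · simp only [traceSum, sum_sub_distrib, sum_add_distrib]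
  · intro ξ hξ
    rw [quarticWeight_eq hψ hξ]
    simp only [MulChar.mul_apply]
    ring

variable [Fintype F]

/-- Bounds for the sums of `f * χ` over the elements of trace `t`, for the characters `χ` of order
prime to `C`, with main term `q` for the trivial one. The numbers `T` and `V` stand
for the sizes of the Fourier transform of `f` on the characters trivial on `F` and on all
characters. -/
def TwistedBound (t : F) (f : E → ℝ) (C : ℕ) (T V : ℝ) : Prop :=
  ∀ (m : ℕ) (χ : MulChar E ℂ), m.Coprime C → χ ^ m = 1 →
    (χ = 1 → ‖traceSum t (fun ξ ↦ f ξ * χ ξ) - Fintype.card F‖ ≤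
      T - 1 + (V - T) * √(Fintype.card F)) ∧
    (χ ≠ 1 → χ ^ (Fintype.card F + 1) = 1 →
      ‖traceSum t (fun ξ ↦ f ξ * χ ξ)‖ ≤ T + (V - T) * √(Fintype.card F)) ∧
    (χ ≠ 1 → ‖traceSum t (fun ξ ↦ f ξ * χ ξ)‖ ≤ V * √(Fintype.card F))

/-- The twists of `χ` by powers of a character of order `ℓ` are nontrivial, so that only the bound
`V * √q` for nontrivial characters is added. -/
theorem TwistedBound.mul_primeWeight {t : F} (ht : t ≠ 0) {f : E → ℝ} {C : ℕ} {T V : ℝ}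
    (h : TwistedBound t f C T V) {ψ : MulChar E ℂ} {ℓ : ℕ} (hℓ : ℓ.Prime) (hψ : orderOf ψ = ℓ)
    (hC : ℓ.Coprime C) :
    TwistedBound t (fun ξ ↦ f ξ * primeWeight ψ ℓ ξ) (C * ℓ) T (2 * V) := by
  have hψ1 : ψ ^ ℓ = 1 := hψ ▸ pow_orderOf_eq_one ψ
  intro m χ hm hχ
  have hmC := Nat.Coprime.coprime_mul_right_right hm
  have hmℓ := Nat.Coprime.coprime_mul_left_right hm
  obtain ⟨a, b, c⟩ := h m χ hmC hχ
  have key := norm_traceSum_mul_primeWeight_sub_le ht f (χ := χ) hℓ.one_lt hψ1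
    (B := V * √(Fintype.card F)) (fun j hj ↦ by
      refine (h (m * ℓ) _ (hmC.mul_left hC) ?_).2.2
        (pow_mul_ne_one_of_coprime hψ hmℓ hχ ?_)
      · rw [mul_pow, pow_mul χ, hχ, one_pow, mul_one, ← pow_mul, mul_comm m, mul_left_comm, pow_mul,
          hψ1, one_pow]
      · rw [mem_Ico] at hj
        exact Nat.not_dvd_of_pos_of_lt hj.1 hj.2)
  refine ⟨fun h1 ↦ ?_, fun h1 h2 ↦ ?_, fun h1 ↦ ?_⟩
  · have := norm_add_le_of_le key (a h1)
    rw [sub_add_sub_cancel] at this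
    linarith
  · have := norm_add_le_of_le key (b h1 h2)
    rw [sub_add_cancel] at this
    linarith
  · have := norm_add_le_of_le key (c h1)
    rw [sub_add_cancel] at this
    linarith

/-- For a character trivial on `F` the twists stay in the class with the small bound. -/
theorem TwistedBound.mul_primeWeight_of_pow_eq_one {t : F} (ht : t ≠ 0) {f : E → ℝ} {C : ℕ}
    {T V : ℝ} (h : TwistedBound t f C T V) {ψ : MulChar E ℂ} {ℓ : ℕ} (hℓ : ℓ.Prime)
    (hψ : orderOf ψ = ℓ) (hC : ℓ.Coprime C) (hψF : ψ ^ (Fintype.card F + 1) = 1) :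
    TwistedBound t (fun ξ ↦ f ξ * primeWeight ψ ℓ ξ) (C * ℓ) (2 * T) (2 * V) := by
  have hψ1 : ψ ^ ℓ = 1 := hψ ▸ pow_orderOf_eq_one ψ
  intro m χ hm hχ
  have hmC := Nat.Coprime.coprime_mul_right_right hm
  have hmℓ := Nat.Coprime.coprime_mul_left_right hm
  obtain ⟨a, b, -⟩ := h m χ hmC hχ
  have key := fun hχF : χ ^ (Fintype.card F + 1) = 1 ↦
    norm_traceSum_mul_primeWeight_sub_le ht f (χ := χ) hℓ.one_lt hψ1
    (B := T + (V - T) * √(Fintype.card F)) (fun j hj ↦ by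
      refine (h (m * ℓ) _ (hmC.mul_left hC) ?_).2.1
        (pow_mul_ne_one_of_coprime hψ hmℓ hχ ?_) ?_
      · rw [mul_pow, pow_mul χ, hχ, one_pow, mul_one, ← pow_mul, mul_comm m, mul_left_comm, pow_mul,
          hψ1, one_pow]
      · rw [mem_Ico] at hj
        exact Nat.not_dvd_of_pos_of_lt hj.1 hj.2
      · rw [mul_pow, hχF, mul_one, ← pow_mul, mul_comm, pow_mul, hψF, one_pow])
  refine ⟨fun h1 ↦ ?_, fun h1 h2 ↦ ?_, (h.mul_primeWeight ht hℓ hψ hC m χ hm hχ).2.2⟩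
  · have := norm_add_le_of_le (key (by rw [h1, one_pow])) (a h1)
    rw [sub_add_sub_cancel] at this
    linarith
  · have := norm_add_le_of_le (key h2) (b h1 h2)
    rw [sub_add_cancel] at this
    linarith

theorem traceSum_one (hE : Fintype.card E = Fintype.card F ^ 2) {t : F} (ht : t ≠ 0) :
    traceSum t (fun ξ ↦ (1 : MulChar E ℂ) ξ) = Fintype.card F := by
  rw [← traceSum_const_one hE t]
  exact traceSum_congr ht fun ξ hξ ↦ MulChar.one_apply (IsUnit.mk0 ξ hξ)

theorem norm_sub_add_sub_le {a b c d : ℂ} {A B C D : ℝ} (ha : ‖a‖ ≤ A) (hb : ‖b‖ ≤ B)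
    (hc : ‖c‖ ≤ C) (hd : ‖d‖ ≤ D) : ‖a - b + c - d‖ ≤ A + B + C + D := by
  refine (norm_sub_le _ _).trans (add_le_add ((norm_add_le _ _).trans (add_le_add
    ((norm_sub_le _ _).trans (add_le_add ha hb)) hc)) hd)

/-- A quartic character is trivial on `F` if `q ≡ 3 mod 4`, and only its square is if
`q ≡ 1 mod 4`. -/
theorem twistedBound_quarticWeight (hE : Fintype.card E = Fintype.card F ^ 2)
    (hodd : Odd (Fintype.card F)) {t : F} (ht : t ≠ 0) {ψ : MulChar E ℂ} (hψ : orderOf ψ = 4) :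
    TwistedBound t (quarticWeight ψ) 2 (if Fintype.card F % 4 = 3 then 4 else 2) 4 := by
  have hψ4 : ψ ^ 4 = 1 := hψ ▸ pow_orderOf_eq_one ψ
  set q := Fintype.card F with hq
  intro m χ hm hχ
  have hm4 : m.Coprime 4 := Nat.Coprime.pow_right 2 hm
  have hne : ∀ j ∈ Ico 1 4, ψ ^ j * χ ≠ 1 := fun j hj ↦
    pow_mul_ne_one_of_coprime hψ hm4 hχ (by
      rw [mem_Ico] at hj; exact Nat.not_dvd_of_pos_of_lt hj.1 hj.2)
  have hs : ∀ j ∈ Ico 1 4, ‖traceSum t (fun ξ ↦ (ψ ^ j * χ) ξ)‖ ≤ √q := fun j hj ↦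
    norm_traceSum_le_sqrt hE (hne j hj) ht
  have h1 : ∀ j ∈ Ico 1 4, χ ^ (q + 1) = 1 → 4 ∣ j * (q + 1) →
      ‖traceSum t (fun ξ ↦ (ψ ^ j * χ) ξ)‖ ≤ 1 := fun j hj hχF hd ↦ by
    refine norm_traceSum_le_one hE (hne j hj) ?_ ht
    obtain ⟨k, hk⟩ := hd
    rw [mul_pow, hχF, mul_one, ← pow_mul, hk, pow_mul, hψ4, one_pow]
  have h1' := hs 1 (by decide)
  have h2' := hs 2 (by decide)
  have h3' := hs 3 (by decide)
  have hone : χ = 1 → traceSum t (fun ξ ↦ χ ξ) = q := fun h ↦ by rw [h, traceSum_one hE ht]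
  rw [traceSum_quarticWeight_mul ht hψ4]
  have hzero : ‖(0 : ℂ)‖ ≤ 0 := by simp
  have hc : ∀ a b c d : ℂ, a - b + c - d - a = 0 - b + c - d := fun a b c d ↦ by ring
  refine ⟨fun h ↦ ?_, fun h hF ↦ ?_, fun h ↦ ?_⟩
  · rw [hone h, hc]
    have hF : χ ^ (q + 1) = 1 := by rw [h, one_pow]
    have h2 := h1 2 (by decide) hF (by obtain ⟨k, hk⟩ := hodd; exact ⟨k + 1, by omega⟩)
    split_ifs with h4
    · have := norm_sub_add_sub_le hzero (h1 1 (by decide) hF (by omega)) h2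
        (h1 3 (by decide) hF (by omega))
      linarith
    · have := norm_sub_add_sub_le hzero h1' h2 h3'
      linarith
  · have h0 := norm_traceSum_le_one hE h hF ht
    have h2 := h1 2 (by decide) hF (by obtain ⟨k, hk⟩ := hodd; exact ⟨k + 1, by omega⟩)
    split_ifs with h4
    · have := norm_sub_add_sub_le h0 (h1 1 (by decide) hF (by omega)) h2
        (h1 3 (by decide) hF (by omega))
      linarith
    · have := norm_sub_add_sub_le h0 h1' h2 h3'
      linarith
  · have := norm_sub_add_sub_le (norm_traceSum_le_sqrt hE h ht) h1' h2' h3'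
    linarith

/-- The sieve inequality. If no element of trace `t` in the support of `f` survives all primes of
`R`, then the total weight of `f` is at most the sum over `ℓ ∈ R` of the weight on `ψ ℓ = 1`, which
is the fraction `1 / ℓ` of the total up to the error terms. -/
theorem TwistedBound.exists_ne_zero {t : F} (ht : t ≠ 0) {f : E → ℝ} (hf : ∀ ξ, 0 ≤ f ξ) {C : ℕ}
    {T V : ℝ} (h : TwistedBound t f C T V) {R : Finset ℕ} {ψ : ℕ → MulChar E ℂ}
    (hR : ∀ ℓ ∈ R, ℓ.Prime ∧ orderOf (ψ ℓ) = ℓ ∧ ℓ.Coprime C)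
    (hδ : ∑ ℓ ∈ R, (1 / ℓ : ℝ) ≤ 1)
    (hineq : ∑ ℓ ∈ R, (1 - 1 / ℓ : ℝ) * (if ℓ ∣ Fintype.card F + 1 then
        T + (V - T) * √(Fintype.card F) else V * √(Fintype.card F)) <
      (1 - ∑ ℓ ∈ R, (1 / ℓ : ℝ)) * (Fintype.card F - (T - 1 + (V - T) * √(Fintype.card F)))) :
    ∃ ξ : E, Algebra.trace F E ξ = t ∧ f ξ ≠ 0 ∧ ∀ ℓ ∈ R, ψ ℓ ξ ≠ 1 := by
  by_contra! hcon
  set q := Fintype.card F with hq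
  set A : Finset E := ({ξ : E | Algebra.trace F E ξ = t} : Finset E) with hA
  have hA0 : ∀ ξ ∈ A, ξ ≠ 0 := by
    rintro ξ hξ rfl
    simp only [hA, map_zero, mem_filter, mem_univ, true_and] at hξ
    exact ht hξ.symm
  have hcast : ∀ g : E → ℝ, traceSum t (fun ξ ↦ (g ξ : ℂ) * (1 : MulChar E ℂ) ξ) =
      ((∑ ξ ∈ A, g ξ : ℝ) : ℂ) := fun g ↦ by
    rw [Complex.ofReal_sum]
    refine sum_congr rfl fun ξ hξ ↦ ?_
    simp only [MulChar.one_apply (IsUnit.mk0 ξ (hA0 ξ hξ)), mul_one]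
  have hs : (q : ℝ) - (T - 1 + (V - T) * √q) ≤ ∑ ξ ∈ A, f ξ := by
    have h1 := (h 1 1 (Nat.coprime_one_left C) (one_pow 1)).1 rfl
    rw [hcast, ← Complex.ofReal_natCast, ← Complex.ofReal_sub, Complex.norm_real,
      Real.norm_eq_abs] at h1
    have := (abs_le.1 h1).1
    linarith
  set s := ∑ ξ ∈ A, f ξ with hs'
  have hpos : ∀ ℓ ∈ R, (1 : ℝ) < ℓ := fun ℓ hℓ ↦ by exact_mod_cast (hR ℓ hℓ).1.one_lt
  have hprime : ∀ ℓ ∈ R, s - (if ℓ ∣ q + 1 then T + (V - T) * √q else V * √q) ≤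
      ∑ ξ ∈ A, f ξ * primeWeight (ψ ℓ) ℓ ξ := fun ℓ hℓ ↦ by
    obtain ⟨hp, ho, hC⟩ := hR ℓ hℓ
    have hψ1 : ψ ℓ ^ ℓ = 1 := orderOf_dvd_iff_pow_eq_one.1 ho.dvd
    have key := norm_traceSum_mul_primeWeight_sub_le ht f (ψ := ψ ℓ) (χ := 1) hp.one_lt hψ1
      (B := if ℓ ∣ q + 1 then T + (V - T) * √q else V * √q) (fun j hj ↦ by
        have hne : ψ ℓ ^ j * 1 ≠ 1 := pow_mul_ne_one_of_coprime ho (Nat.coprime_one_left ℓ)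
          (one_pow 1) (by rw [mem_Ico] at hj; exact Nat.not_dvd_of_pos_of_lt hj.1 hj.2)
        have hb := h ℓ (ψ ℓ ^ j * 1) hC (by
          rw [mul_one, ← pow_mul, mul_comm, pow_mul, hψ1, one_pow])
        split_ifs with hd
        · exact hb.2.1 hne (by
            rw [mul_one, ← pow_mul, mul_comm, pow_mul,
              orderOf_dvd_iff_pow_eq_one.1 (ho.dvd.trans hd), one_pow])
        · exact hb.2.2 hne)
    rw [hcast, hcast, ← Complex.ofReal_sub, Complex.norm_real, Real.norm_eq_abs] at key
    have := (abs_le.1 key).1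
    linarith
  have hcover : s ≤ ∑ ℓ ∈ R, ∑ ξ ∈ A, f ξ * (1 - (1 - 1 / ℓ) * primeWeight (ψ ℓ) ℓ ξ) := by
    have hterm : ∀ ℓ ∈ R, ∀ ξ, (1 - (1 - 1 / (ℓ : ℝ)) * primeWeight (ψ ℓ) ℓ ξ) =
        open Classical in if ψ ℓ ξ = 1 then 1 else 0 := fun ℓ hℓ ξ ↦ by
      have := hpos ℓ hℓ
      have h3 : (ℓ : ℝ) - 1 ≠ 0 := by linarith
      have h4 : (ℓ : ℝ) ≠ 0 := by linarith
      unfold primeWeight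
      split_ifs
      · simp
      · field_simp
        ring
    rw [sum_comm]
    refine sum_le_sum fun ξ hξ ↦ ?_
    by_cases hfξ : f ξ = 0
    · simp [hfξ]
    · obtain ⟨ℓ, hℓ, hψℓ⟩ := hcon ξ (by simpa [hA] using hξ) hfξ
      refine le_trans ?_ (single_le_sum (f := fun ℓ : ℕ ↦
        f ξ * (1 - (1 - 1 / (ℓ : ℝ)) * primeWeight (ψ ℓ) ℓ ξ)) (fun k hk ↦ ?_) hℓ)
      · simp only [hterm ℓ hℓ, hψℓ, if_true, mul_one, le_refl]
      · simp only [hterm k hk]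
        split_ifs <;> simp [hf ξ]
  have hbound : ∑ ℓ ∈ R, ∑ ξ ∈ A, f ξ * (1 - (1 - 1 / ℓ) * primeWeight (ψ ℓ) ℓ ξ) ≤
      ∑ ℓ ∈ R, (1 / ℓ * s + (1 - 1 / ℓ : ℝ) *
        (if ℓ ∣ q + 1 then T + (V - T) * √q else V * √q)) := by
    refine sum_le_sum fun ℓ hℓ ↦ ?_
    have h1 := hpos ℓ hℓ
    have h2 : 0 ≤ 1 - 1 / (ℓ : ℝ) := by
      rw [sub_nonneg, div_le_one (by linarith)]; exact h1.le
    have h3 := mul_le_mul_of_nonneg_left (hprime ℓ hℓ) h2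
    have h4 : ∑ ξ ∈ A, f ξ * (1 - (1 - 1 / (ℓ : ℝ)) * primeWeight (ψ ℓ) ℓ ξ) =
        s - (1 - 1 / ℓ) * ∑ ξ ∈ A, f ξ * primeWeight (ψ ℓ) ℓ ξ := by
      rw [hs', mul_sum, ← sum_sub_distrib]
      exact sum_congr rfl fun ξ _ ↦ by ring
    rw [h4]
    linarith
  rw [sum_add_distrib, ← sum_mul] at hbound
  have h5 := mul_le_mul_of_nonneg_left hs (sub_nonneg.2 hδ)
  linarith

end Sieve

/-! ### From the sieve to elements of given order -/

section PrimitiveElements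

open Finset

variable {F E : Type*} [Field F] [Field E] [Fintype F] [Fintype E] [Algebra F E]

/-- The bounds for a set `C` of odd primes: `V` doubles with every prime, and `T` only with the
divisors of `q + 1`, whose characters are trivial on `F`. -/
theorem twistedBound_prod [DecidableEq F] (hE : Fintype.card E = Fintype.card F ^ 2)
    (hodd : Odd (Fintype.card F)) {t : F} (ht : t ≠ 0) {ψ₄ : MulChar E ℂ} (hψ₄ : orderOf ψ₄ = 4)
    {ψ : ℕ → MulChar E ℂ} (C : Finset ℕ) (hC : ∀ ℓ ∈ C, ℓ.Prime ∧ ℓ ≠ 2 ∧ orderOf (ψ ℓ) = ℓ) :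
    TwistedBound t (fun ξ ↦ quarticWeight ψ₄ ξ * ∏ ℓ ∈ C, primeWeight (ψ ℓ) ℓ ξ) (2 * ∏ ℓ ∈ C, ℓ)
      ((if Fintype.card F % 4 = 3 then 4 else 2) * 2 ^ #{ℓ ∈ C | ℓ ∣ Fintype.card F + 1})
      (4 * 2 ^ #C) := by
  induction C using Finset.induction_on with
  | empty => simpa using twistedBound_quarticWeight hE hodd ht hψ₄
  | insert ℓ C hℓ ih =>
    obtain ⟨hp, h2, ho⟩ := hC ℓ (mem_insert_self ℓ C)
    have ih := ih fun k hk ↦ hC k (mem_insert_of_mem hk)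
    have hcop : ℓ.Coprime (2 * ∏ k ∈ C, k) := by
      refine Nat.Coprime.mul_right ((Nat.coprime_primes hp Nat.prime_two).2 h2)
        (Nat.Coprime.prod_right fun k hk ↦ ?_)
      refine (Nat.coprime_primes hp (hC k (mem_insert_of_mem hk)).1).2 ?_
      rintro rfl
      exact hℓ hk
    rw [prod_insert hℓ, card_insert_of_notMem hℓ, filter_insert, mul_comm ℓ, ← mul_assoc]
    have hV : (4 : ℝ) * 2 ^ (#C + 1) = 2 * (4 * 2 ^ #C) := by ring
    simp only [prod_insert hℓ]
    simp only [mul_comm (primeWeight (ψ ℓ) ℓ _), ← mul_assoc]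
    rw [hV]
    by_cases hd : ℓ ∣ Fintype.card F + 1
    · rw [if_pos hd, card_insert_of_notMem (fun h ↦ hℓ (mem_filter.1 h).1), pow_succ',
        mul_left_comm]
      exact ih.mul_primeWeight_of_pow_eq_one ht hp ho hcop
        (orderOf_dvd_iff_pow_eq_one.1 (ho.dvd.trans hd))
    · rw [if_neg hd]
      exact ih.mul_primeWeight ht hp ho hcop

/-- A character whose order is the order of the unit group is injective on units. -/
theorem MulChar.eq_one_of_apply_eq_one {X : MulChar E ℂ} (hX : orderOf X = Fintype.card E - 1)
    {x : E} (hx : X x = 1) : x = 1 := by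
  classical
  have hx0 : x ≠ 0 := by
    rintro rfl
    rw [MulChar.map_zero] at hx
    exact zero_ne_one hx
  obtain ⟨g, hg⟩ := IsCyclic.exists_generator (α := Eˣ)
  obtain ⟨k, hk⟩ := mem_powers_iff_mem_zpowers.2 (hg (Units.mk0 x hx0))
  have hk' : g ^ k = Units.mk0 x hx0 := hk
  have h1 : X ^ k = 1 := by
    rw [MulChar.eq_iff hg, MulChar.pow_apply_coe, MulChar.one_apply_coe, ← map_pow,
      ← Units.val_pow_eq_pow_val, hk', Units.val_mk0, hx]
  have h2 := orderOf_dvd_of_pow_eq_one h1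
  rw [hX, ← Fintype.card_units] at h2
  obtain ⟨c, rfl⟩ := h2
  rw [pow_mul, pow_card_eq_one, one_pow] at hk'
  simpa using (congrArg Units.val hk').symm

/-- The quartic condition makes `ξ` a square but not a fourth power, and the condition at `ℓ` makes
it not an `ℓ`-th power. -/
theorem orderOf_eq_half_of_characters {X : MulChar E ℂ} (hX : orderOf X = Fintype.card E - 1)
    (h4 : 4 ∣ Fintype.card E - 1) {ξ : E} (hξ4 : (X ^ ((Fintype.card E - 1) / 4)) ξ = -1)
    (hξ : ∀ ℓ ∈ (Fintype.card E - 1).primeFactors.erase 2,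
      (X ^ ((Fintype.card E - 1) / ℓ)) ξ ≠ 1) :
    orderOf ξ = (Fintype.card E - 1) / 2 := by
  have hE1 := Fintype.one_lt_card (α := E)
  set n := Fintype.card E - 1 with hn
  have hn0 : 0 < n := by omega
  have hξ0 : ξ ≠ 0 := by
    rintro rfl
    rw [MulChar.map_zero] at hξ4
    norm_num at hξ4
  have hpow : ∀ d, d ≠ 0 → (X ^ d) ξ = X (ξ ^ d) := fun d hd ↦ by
    rw [MulChar.pow_apply' _ hd, map_pow]
  refine orderOf_eq_of_pow_and_pow_div_prime (by omega) ?_ ?_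
  · refine MulChar.eq_one_of_apply_eq_one hX ?_
    have h2 : n / 2 = n / 4 * 2 := by omega
    rw [h2, pow_mul, map_pow, ← hpow _ (by omega), hξ4]
    norm_num
  · intro p hp hpn h
    by_cases hp2 : p = 2
    · subst hp2
      rw [Nat.div_div_eq_div_mul] at h
      rw [hpow _ (by omega), h, map_one] at hξ4
      norm_num at hξ4
    · have hpn' : p ∣ n := hpn.trans (Nat.div_dvd_of_dvd (by omega))
      refine hξ p (mem_erase.2 ⟨hp2, Nat.mem_primeFactors.2 ⟨hp, hpn', hn0.ne'⟩⟩) ?_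
      obtain ⟨k, hk⟩ := hpn
      have h2 : n / p = k * 2 := by
        have : n = p * (k * 2) := by rw [← mul_assoc, ← hk]; omega
        rw [this, Nat.mul_div_cancel_left _ hp.pos]
      have h3 : n / 2 / p = k := by rw [hk, Nat.mul_div_cancel_left _ hp.pos]
      have hk0 : k ≠ 0 := by rintro rfl; omega
      rw [h3] at h
      rw [h2, hpow _ (by omega), pow_mul, h, one_pow, map_one]

/-- The sieve criterion: `C` is the set of primes kept in the main character sum and `R` the set of
primes that are sieved. The factors `4` or `2` in `T` and `4` in `V` come from the quartic
condition. -/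
def SieveCriterion (q : ℕ) : Prop :=
  ∃ C R : Finset ℕ, C ∪ R = (q ^ 2 - 1).primeFactors.erase 2 ∧ Disjoint C R ∧
    ∃ T V : ℝ, T = (if q % 4 = 3 then 4 else 2) * 2 ^ #{ℓ ∈ C | ℓ ∣ q + 1} ∧ V = 4 * 2 ^ #C ∧
    ∑ ℓ ∈ R, (1 / ℓ : ℝ) ≤ 1 ∧
    ∑ ℓ ∈ R, (1 - 1 / ℓ : ℝ) * (if ℓ ∣ q + 1 then T + (V - T) * √q else V * √q) <
      (1 - ∑ ℓ ∈ R, (1 / ℓ : ℝ)) * (q - (T - 1 + (V - T) * √q))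

theorem SieveCriterion.exists_isRPrimitive {q : ℕ} (h : SieveCriterion q) (hodd : Odd q)
    (hF : Fintype.card F = q) (hE : Fintype.card E = q ^ 2) {t : F} (ht : t ≠ 0) :
    ∃ ξ : E, IsRPrimitive 2 ξ ∧ Algebra.trace F E ξ = t := by
  classical
  obtain ⟨C, R, hCR, hdisj, T, V, hT, hV, hδ, hineq⟩ := h
  subst hF
  set q := Fintype.card F
  have hq1 : 1 < q := Fintype.one_lt_card
  have h4 : 4 ∣ q ^ 2 - 1 := by
    obtain ⟨k, hk⟩ := hodd
    exact ⟨k ^ 2 + k, by rw [hk]; ring_nf; omega⟩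
  have hn0 : q ^ 2 - 1 ≠ 0 := by
    have : 1 < q ^ 2 := Nat.one_lt_pow (by omega) hq1
    omega
  obtain ⟨X, hX⟩ := MulChar.exists_mulChar_orderOf (R := ℂ) E (n := q ^ 2 - 1) (by rw [hE])
    (Complex.isPrimitiveRoot_exp _ hn0)
  have hord : ∀ d, d ∣ q ^ 2 - 1 → orderOf (X ^ ((q ^ 2 - 1) / d)) = d := fun d hd ↦ by
    rw [← hX] at hd hn0 ⊢
    exact orderOf_pow_orderOf_div hn0 hd
  have hmem : ∀ ℓ ∈ C ∪ R, ℓ.Prime ∧ ℓ ≠ 2 ∧ orderOf (X ^ ((q ^ 2 - 1) / ℓ)) = ℓ := fun ℓ hℓ ↦ by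
    rw [hCR, mem_erase, Nat.mem_primeFactors] at hℓ
    exact ⟨hℓ.2.1, hℓ.1, hord ℓ hℓ.2.2.1⟩
  have hTB := twistedBound_prod hE hodd ht (hord 4 h4) (ψ := fun ℓ ↦ X ^ ((q ^ 2 - 1) / ℓ)) C
    fun ℓ hℓ ↦ hmem ℓ (mem_union_left R hℓ)
  rw [← hT, ← hV] at hTB
  obtain ⟨ξ, hξt, hξ0, hξR⟩ := hTB.exists_ne_zero ht (R := R)
    (ψ := fun ℓ ↦ X ^ ((q ^ 2 - 1) / ℓ))
    (fun ξ ↦ mul_nonneg (by unfold quarticWeight; split_ifs <;> norm_num)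
      (prod_nonneg fun ℓ hℓ ↦ primeWeight_nonneg _ (hmem ℓ (mem_union_left R hℓ)).1.one_lt ξ))
    (fun ℓ hℓ ↦ by
      obtain ⟨hp, h2, ho⟩ := hmem ℓ (mem_union_right C hℓ)
      refine ⟨hp, ho, Nat.Coprime.mul_right ((Nat.coprime_primes hp Nat.prime_two).2 h2)
        (Nat.Coprime.prod_right fun k hk ↦
          (Nat.coprime_primes hp (hmem k (mem_union_left R hk)).1).2 ?_)⟩
      rintro rfl
      exact disjoint_left.1 hdisj hk hℓ)
    hδ hineq
  have hξ4 : (X ^ ((q ^ 2 - 1) / 4)) ξ = -1 := by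
    by_contra hne
    exact left_ne_zero_of_mul hξ0 (if_neg hne)
  have hξC : ∀ ℓ ∈ C, (X ^ ((q ^ 2 - 1) / ℓ)) ξ ≠ 1 := fun ℓ hℓ heq ↦
    prod_ne_zero_iff.1 (right_ne_zero_of_mul hξ0) ℓ hℓ (if_pos heq)
  refine ⟨ξ, ⟨?_, ?_, ?_⟩, hξt⟩
  · rw [Nat.card_eq_fintype_card, hE]
    exact Dvd.dvd.trans (by norm_num) h4
  · rintro rfl
    rw [map_zero] at hξt
    exact ht hξt.symm
  · rw [Nat.card_eq_fintype_card]
    refine orderOf_eq_half_of_characters (X := X) (by rw [hX, hE]) (by rwa [hE]) (by rwa [hE]) ?_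
    rw [hE, ← hCR]
    intro ℓ hℓ
    rcases mem_union.1 hℓ with hl | hl
    · exact hξC ℓ hl
    · exact hξR ℓ hl

end PrimitiveElements

/-! ### Evaluation of the criterion for small `q` -/

section SmallFields

open Finset

/-- The list of the prime factors of `n`, all of them assumed to be at least `d`, by trial division
with `d`, `d + 2`, … (and `2`, `3`, `5`, … for `d = 2`); the first argument is fuel. -/
def trialFactors : ℕ → ℕ → ℕ → List ℕ
  | 0, _, _ => []
  | k + 1, d, n =>
    bif n.blt (d * d) then (bif n.ble 1 then [] else [n])
    else bif (n % d).beq 0 then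
      (bif ((n / d) % d).beq 0 then trialFactors k d (n / d)
        else d :: trialFactors k (d + 1 + d % 2) (n / d))
    else trialFactors k (d + 1 + d % 2) n

theorem le_of_trial_step {d p : ℕ} (hd : d = 2 ∨ 3 ≤ d ∧ d % 2 = 1) (hp : p.Prime) (hdp : d ≤ p)
    (hne : p ≠ d) : d + 1 + d % 2 ≤ p := by
  rcases hp.eq_two_or_odd with h | h <;> rcases hd with h' | h' <;> omega

theorem trialFactors_spec (k : ℕ) : ∀ d n : ℕ, (d = 2 ∨ 3 ≤ d ∧ d % 2 = 1) → 0 < n → n < k + d →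
    (∀ p : ℕ, p.Prime → p ∣ n → d ≤ p) →
    (trialFactors k d n).Nodup ∧ ∀ p, p ∈ trialFactors k d n ↔ p.Prime ∧ p ∣ n := by
  induction k with
  | zero =>
    intro d n _ hn hnd hp
    have hn1 : n = 1 := by
      by_contra h
      have h1 := hp _ (Nat.minFac_prime h) (Nat.minFac_dvd n)
      have h2 := Nat.minFac_le hn
      omega
    subst hn1
    refine ⟨List.nodup_nil, fun p ↦ ⟨fun h ↦ by simp [trialFactors] at h, fun h ↦ ?_⟩⟩
    exact absurd (Nat.dvd_one.1 h.2) h.1.ne_one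
  | succ k ih =>
    intro d n hd hn hnd hp
    have hd2 : 2 ≤ d := by omega
    have hd' : d + 1 + d % 2 = 2 ∨ 3 ≤ d + 1 + d % 2 ∧ (d + 1 + d % 2) % 2 = 1 := by omega
    unfold trialFactors
    by_cases h1 : n < d * d
    · have e1 : n.blt (d * d) = true := by rw [Nat.blt_eq]; exact h1
      rw [e1, cond_true]
      by_cases h2 : n ≤ 1
      · have e2 : n.ble 1 = true := by rw [Nat.ble_eq]; exact h2
        have hn1 : n = 1 := by omega
        rw [e2, cond_true]
        subst hn1
        refine ⟨List.nodup_nil, fun p ↦ ⟨fun h ↦ by simp at h, fun h ↦ ?_⟩⟩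
        exact absurd (Nat.dvd_one.1 h.2) h.1.ne_one
      · have e2 : n.ble 1 = false := by
          rw [Bool.eq_false_iff, ne_eq, Nat.ble_eq]; exact h2
        rw [e2, cond_false]
        have hnp : n.Prime := by
          by_contra hnp
          have h3 := Nat.minFac_sq_le_self hn hnp
          have h4 := hp _ (Nat.minFac_prime (by omega)) (Nat.minFac_dvd n)
          nlinarith
        refine ⟨List.nodup_singleton n, fun p ↦ ?_⟩
        rw [List.mem_singleton]
        exact ⟨fun h ↦ ⟨h.symm ▸ hnp, h.dvd⟩, fun h ↦ (Nat.prime_dvd_prime_iff_eq h.1 hnp).1 h.2⟩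
    · have e1 : n.blt (d * d) = false := by
        rw [Bool.eq_false_iff, ne_eq, Nat.blt_eq]; exact h1
      rw [e1, cond_false]
      have hn4 : 4 ≤ n := by nlinarith
      by_cases h2 : n % d = 0
      · have hdn : d ∣ n := Nat.dvd_of_mod_eq_zero h2
        have e2 : (n % d).beq 0 = true := by rw [Nat.beq_eq]; exact h2
        rw [e2, cond_true]
        have hdp : d.Prime := by
          have h3 := hp _ (Nat.minFac_prime (n := d) (by omega)) ((Nat.minFac_dvd d).trans hdn)
          have h4 := Nat.minFac_le (n := d) (by omega)
          rw [← le_antisymm h4 h3]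
          exact Nat.minFac_prime (by omega)
        have hdiv : d * (n / d) = n := Nat.mul_div_cancel' hdn
        have hpos : 0 < n / d := Nat.div_pos (Nat.le_of_dvd hn hdn) hdp.pos
        have hlt : n / d < n := Nat.div_lt_self hn (by omega)
        have hsub : ∀ p : ℕ, p ∣ n / d → p ∣ n := fun p h ↦ h.trans (Nat.div_dvd_of_dvd hdn)
        have hmem : ∀ p : ℕ, p.Prime → (p ∣ n ↔ p = d ∨ p ∣ n / d) := fun p h ↦ by
          conv_lhs => rw [← hdiv]
          rw [h.dvd_mul, Nat.prime_dvd_prime_iff_eq h hdp]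
        by_cases h3 : n / d % d = 0
        · have e3 : (n / d % d).beq 0 = true := by rw [Nat.beq_eq]; exact h3
          rw [e3, cond_true]
          obtain ⟨a, b⟩ := ih d (n / d) hd hpos (by omega) fun p h h' ↦ hp p h (hsub p h')
          refine ⟨a, fun p ↦ ?_⟩
          rw [b p]
          refine ⟨fun h ↦ ⟨h.1, hsub p h.2⟩, fun h ↦ ⟨h.1, ?_⟩⟩
          rcases (hmem p h.1).1 h.2 with rfl | h4
          · exact Nat.dvd_of_mod_eq_zero h3
          · exact h4
        · have e3 : (n / d % d).beq 0 = false := by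
            rw [Bool.eq_false_iff, ne_eq, Nat.beq_eq]; exact h3
          have hnd' : ¬ d ∣ n / d := fun h ↦ h3 (Nat.mod_eq_zero_of_dvd h)
          rw [e3, cond_false]
          obtain ⟨a, b⟩ := ih (d + 1 + d % 2) (n / d) hd' hpos (by omega) fun p h h' ↦
            le_of_trial_step hd h (hp p h (hsub p h')) (by rintro rfl; exact hnd' h')
          refine ⟨List.nodup_cons.2 ⟨fun h ↦ hnd' ((b d).1 h).2, a⟩, fun p ↦ ?_⟩
          rw [List.mem_cons, b p]
          constructor
          · rintro (rfl | h)
            · exact ⟨hdp, hdn⟩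
            · exact ⟨h.1, hsub p h.2⟩
          · intro h
            rcases (hmem p h.1).1 h.2 with h4 | h4
            · exact Or.inl h4
            · exact Or.inr ⟨h.1, h4⟩
      · have e2 : (n % d).beq 0 = false := by
          rw [Bool.eq_false_iff, ne_eq, Nat.beq_eq]; exact h2
        rw [e2, cond_false]
        exact ih (d + 1 + d % 2) n hd' hn (by omega) fun p h h' ↦
          le_of_trial_step hd h (hp p h h') (by rintro rfl; exact h2 (Nat.mod_eq_zero_of_dvd h'))

/-- The list of the odd prime factors of `n`. -/
def oddFactors (n : ℕ) : List ℕ := (trialFactors n 2 n).filter fun p ↦ Nat.blt 2 p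

theorem nodup_trialFactors_two {n : ℕ} (hn : 0 < n) : (trialFactors n 2 n).Nodup :=
  (trialFactors_spec n 2 n (Or.inl rfl) hn (by omega) fun _ h _ ↦ h.two_le).1

theorem mem_trialFactors_two {n : ℕ} (hn : 0 < n) {p : ℕ} :
    p ∈ trialFactors n 2 n ↔ p.Prime ∧ p ∣ n :=
  (trialFactors_spec n 2 n (Or.inl rfl) hn (by omega) fun _ h _ ↦ h.two_le).2 p

theorem nodup_oddFactors {n : ℕ} (hn : 0 < n) : (oddFactors n).Nodup :=
  (nodup_trialFactors_two hn).filter _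

theorem mem_oddFactors {n : ℕ} (hn : 0 < n) {p : ℕ} :
    p ∈ oddFactors n ↔ (p.Prime ∧ p ≠ 2) ∧ p ∣ n := by
  rw [oddFactors, List.mem_filter, mem_trialFactors_two hn, Nat.blt_eq]
  constructor
  · rintro ⟨⟨h1, h2⟩, h3⟩
    exact ⟨⟨h1, h3.ne'⟩, h2⟩
  · rintro ⟨⟨h1, h3⟩, h2⟩
    exact ⟨⟨h1, h2⟩, lt_of_le_of_ne h1.two_le h3.symm⟩

/-- The sum of the quotients `D / p` for `p` in `l`. -/
def quotientSum (D : ℕ) (l : List ℕ) : ℕ := (l.map fun p ↦ D / p).sum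

/-- The inequality of the sieve criterion, multiplied by the product of the sieved primes and
squared: `S` and `R` are the sieved primes dividing `q + 1` and `q - 1`, and `c` and `e` are the
numbers of the primes of both kinds that are not sieved. -/
def sieveInequality (q c e : ℕ) (S R : List ℕ) : Bool :=
  let D := S.prod * R.prod
  let u := quotientSum D S
  let v := quotientSum D R
  let T := (bif (q % 4).beq 3 then 4 else 2) * 2 ^ c
  let V := 4 * 2 ^ (c + e)
  let δ := D - (u + v)
  let a := δ * T + (S.length * D - u) * T
  let B := δ * (V - T) + (S.length * D - u) * (V - T) + (R.length * D - v) * V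
  (u + v).ble D &&
    (a.blt (δ * (q + 1)) && (B * B * q).blt ((δ * (q + 1) - a) * (δ * (q + 1) - a)))

/-- The sieve inequality for the prime divisors `P` of `q + 1` and `M` of `q - 1`, where the primes
greater than `b` are sieved. -/
def sieveTest (q b : ℕ) (P M : List ℕ) : Bool :=
  sieveInequality q (P.filter fun p ↦ p.ble b).length (M.filter fun p ↦ p.ble b).length
    (P.filter fun p ↦ b.blt p) (M.filter fun p ↦ b.blt p)

/-- The test that settles a small odd number `q`: the sieve applies, or `q` has two prime
factors, or `q` is in the list of exceptions. -/
def smallTest (q : ℕ) : Bool :=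
  sieveTest q 2 (oddFactors (q + 1)) (oddFactors (q - 1)) ||
    (sieveTest q 3 (oddFactors (q + 1)) (oddFactors (q - 1)) ||
      (Nat.ble 2 (trialFactors q 2 q).length || decide (q ∈ exceptionalOrders)))

theorem quotientSum_div {D : ℕ} (hD : D ≠ 0) {l : List ℕ} (h : ∀ p ∈ l, p ∣ D) :
    (quotientSum D l : ℝ) = D * (l.map fun p : ℕ ↦ (1 / p : ℝ)).sum := by
  induction l with
  | nil => simp [quotientSum]
  | cons p l ih =>
    have hp := h p List.mem_cons_self
    have hp0 : (p : ℝ) ≠ 0 := by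
      rintro h0
      rw [Nat.cast_eq_zero] at h0
      subst h0
      exact hD (Nat.eq_zero_of_zero_dvd hp)
    have ih := ih fun r hr ↦ h r (List.mem_cons_of_mem _ hr)
    unfold quotientSum at ih ⊢
    rw [List.map_cons, List.sum_cons, List.map_cons, List.sum_cons, Nat.cast_add, ih,
      Nat.cast_div hp hp0]
    ring

theorem quotientSum_le (D : ℕ) (l : List ℕ) : quotientSum D l ≤ l.length * D := by
  induction l with
  | nil => simp [quotientSum]
  | cons p l ih =>
    have := Nat.div_le_self D p
    unfold quotientSum at ih ⊢
    rw [List.map_cons, List.sum_cons, List.length_cons]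
    linarith

theorem sum_map_one_sub {l : List ℕ} (x : ℝ) :
    (l.map fun p : ℕ ↦ (1 - 1 / p : ℝ) * x).sum =
      (l.length - (l.map fun p : ℕ ↦ (1 / p : ℝ)).sum) * x := by
  induction l with
  | nil => simp
  | cons p l ih => simp only [List.map_cons, List.sum_cons, List.length_cons, ih]; push_cast; ring

theorem sieveInequality_spec {q c e : ℕ} {S R : List ℕ} (h : sieveInequality q c e S R = true)
    (hS : ∀ p ∈ S, 0 < p) (hR : ∀ p ∈ R, 0 < p) {T V σ ρ : ℝ}
    (hT : T = (if q % 4 = 3 then 4 else 2) * 2 ^ c) (hV : V = 4 * 2 ^ (c + e))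
    (hσ : σ = (S.map fun p : ℕ ↦ (1 / p : ℝ)).sum) (hρ : ρ = (R.map fun p : ℕ ↦ (1 / p : ℝ)).sum) :
    σ + ρ ≤ 1 ∧ (S.length - σ) * (T + (V - T) * √q) + (R.length - ρ) * (V * √q) <
      (1 - (σ + ρ)) * (q - (T - 1 + (V - T) * √q)) := by
  unfold sieveInequality at h
  extract_lets D u v T' V' δ a B at h
  rw [Bool.and_eq_true, Bool.and_eq_true, Nat.ble_eq, Nat.blt_eq, Nat.blt_eq] at h
  obtain ⟨h1, h2, h3⟩ := h
  have hD : D ≠ 0 := mul_ne_zero (List.prod_ne_zero fun h0 ↦ (hS 0 h0).ne' rfl)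
    (List.prod_ne_zero fun h0 ↦ (hR 0 h0).ne' rfl)
  have hDpos : (0 : ℝ) < D := by exact_mod_cast Nat.pos_of_ne_zero hD
  have hu : (u : ℝ) = D * σ := by
    rw [hσ]; exact quotientSum_div hD fun p hp ↦ (List.dvd_prod hp).mul_right _
  have hv : (v : ℝ) = D * ρ := by
    rw [hρ]; exact quotientSum_div hD fun p hp ↦ (List.dvd_prod hp).mul_left _
  have hT' : (T' : ℝ) = T := by
    rw [hT]
    simp only [T']
    by_cases h4 : q % 4 = 3
    · simp [h4]
    · have : (q % 4).beq 3 = false := by rw [Bool.eq_false_iff, ne_eq, Nat.beq_eq]; exact h4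
      simp [h4, this]
  have hV' : (V' : ℝ) = V := by rw [hV]; simp [V']
  have hTV : T' ≤ V' := by
    simp only [T', V', pow_add]
    have h5 : (bif (q % 4).beq 3 then 4 else 2) ≤ 4 := by
      cases (q % 4).beq 3 <;> simp
    calc _ ≤ 4 * 2 ^ c := Nat.mul_le_mul_right _ h5
      _ ≤ 4 * (2 ^ c * 2 ^ e) :=
        Nat.mul_le_mul_left _ (Nat.le_mul_of_pos_right _ (by positivity))
  have hδ : (δ : ℝ) = D * (1 - (σ + ρ)) := by
    simp only [δ]
    rw [Nat.cast_sub h1, Nat.cast_add, hu, hv]; ring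
  have hu' : ((S.length * D - u : ℕ) : ℝ) = D * (S.length - σ) := by
    rw [Nat.cast_sub (quotientSum_le D S), hu]; push_cast; ring
  have hv' : ((R.length * D - v : ℕ) : ℝ) = D * (R.length - ρ) := by
    rw [Nat.cast_sub (quotientSum_le D R), hv]; push_cast; ring
  have hVT : ((V' - T' : ℕ) : ℝ) = V - T := by rw [Nat.cast_sub hTV, hV', hT']
  have ha : (a : ℝ) = D * (1 - (σ + ρ)) * T + D * (S.length - σ) * T := by
    simp only [a]
    push_cast [hδ, hu', hT']
    ring
  have hB : (B : ℝ) = D * (1 - (σ + ρ)) * (V - T) + D * (S.length - σ) * (V - T) +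
      D * (R.length - ρ) * V := by
    simp only [B]
    push_cast [hδ, hu', hv', hVT, hV']
    ring
  have hroot : (B : ℝ) * √q < D * (1 - (σ + ρ)) * (q + 1) - a := by
    have h6 : ((δ * (q + 1) - a : ℕ) : ℝ) = D * (1 - (σ + ρ)) * (q + 1) - a := by
      rw [Nat.cast_sub h2.le]; push_cast [hδ]; ring
    rw [← h6]
    refine lt_of_pow_lt_pow_left₀ 2 (Nat.cast_nonneg _) ?_
    rw [mul_pow, Real.sq_sqrt (Nat.cast_nonneg q), sq, sq]
    exact_mod_cast h3
  rw [ha, hB] at hroot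
  constructor
  · have h7 : (u : ℝ) + v ≤ D := by exact_mod_cast h1
    rw [hu, hv] at h7
    nlinarith
  · refine lt_of_mul_lt_mul_left ?_ hDpos.le
    linarith

theorem sieveCriterion_of_sieveTest {q b : ℕ} (hq : 1 < q)
    (h : sieveTest q b (oddFactors (q + 1)) (oddFactors (q - 1)) = true) : SieveCriterion q := by
  set P := oddFactors (q + 1) with hP
  set M := oddFactors (q - 1) with hM
  have hPn : P.Nodup := nodup_oddFactors (by omega)
  have hMn : M.Nodup := nodup_oddFactors (by omega)
  have hPm : ∀ p, p ∈ P ↔ (p.Prime ∧ p ≠ 2) ∧ p ∣ q + 1 := fun p ↦ mem_oddFactors (by omega)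
  have hMm : ∀ p, p ∈ M ↔ (p.Prime ∧ p ≠ 2) ∧ p ∣ q - 1 := fun p ↦ mem_oddFactors (by omega)
  have hPM : ∀ p, p ∈ P → p ∉ M := fun p h1 h2 ↦ by
    rw [hPm] at h1
    rw [hMm] at h2
    have h3 := Nat.dvd_sub h1.2 h2.2
    rw [show q + 1 - (q - 1) = 2 by omega] at h3
    exact h1.1.2 ((Nat.prime_dvd_prime_iff_eq h1.1.1 Nat.prime_two).1 h3)
  set S := P.filter fun p ↦ b.blt p with hS
  set R := M.filter fun p ↦ b.blt p with hR
  set c := P.filter fun p ↦ p.ble b with hc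
  set e := M.filter fun p ↦ p.ble b with he
  have hb : ∀ p, p.ble b = true ↔ ¬ b.blt p = true := fun p ↦ by
    rw [Nat.ble_eq, Nat.blt_eq, not_lt]
  have hsub : ∀ p, p ∣ q ^ 2 - 1 ↔ p ∣ (q + 1) * (q - 1) := fun p ↦ by
    rw [← Nat.sq_sub_sq, one_pow]
  have hq2 : q ^ 2 - 1 ≠ 0 := by
    have : 1 < q ^ 2 := Nat.one_lt_pow (by omega) hq
    omega
  have hSR : Disjoint S.toFinset R.toFinset := by
    rw [disjoint_left]
    intro p h1 h2
    rw [List.mem_toFinset] at h1 h2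
    exact hPM p (List.mem_of_mem_filter h1) (List.mem_of_mem_filter h2)
  have hce : Disjoint c.toFinset e.toFinset := by
    rw [disjoint_left]
    intro p h1 h2
    rw [List.mem_toFinset] at h1 h2
    exact hPM p (List.mem_of_mem_filter h1) (List.mem_of_mem_filter h2)
  have hSd : ∀ p ∈ S, p ∣ q + 1 := fun p hp ↦ ((hPm p).1 (List.mem_of_mem_filter hp)).2
  have hRd : ∀ p ∈ R, ¬ p ∣ q + 1 := fun p hp hd ↦
    hPM p ((hPm p).2 ⟨((hMm p).1 (List.mem_of_mem_filter hp)).1, hd⟩) (List.mem_of_mem_filter hp)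
  have hcd : ∀ p ∈ c, p ∣ q + 1 := fun p hp ↦ ((hPm p).1 (List.mem_of_mem_filter hp)).2
  have hed : ∀ p ∈ e, ¬ p ∣ q + 1 := fun p hp hd ↦
    hPM p ((hPm p).2 ⟨((hMm p).1 (List.mem_of_mem_filter hp)).1, hd⟩) (List.mem_of_mem_filter hp)
  have hcF : #{ℓ ∈ c.toFinset ∪ e.toFinset | ℓ ∣ q + 1} = c.length := by
    rw [filter_union, filter_true_of_mem (fun p hp ↦ hcd p (List.mem_toFinset.1 hp)),
      filter_false_of_mem (fun p hp ↦ hed p (List.mem_toFinset.1 hp)), union_empty,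
      List.toFinset_card_of_nodup (hPn.filter _)]
  have hceC : #(c.toFinset ∪ e.toFinset) = c.length + e.length := by
    rw [card_union_of_disjoint hce, List.toFinset_card_of_nodup (hPn.filter _),
      List.toFinset_card_of_nodup (hMn.filter _)]
  have hsumS : ∀ X Y : ℝ, ∑ ℓ ∈ S.toFinset, (1 - 1 / ℓ : ℝ) * (if ℓ ∣ q + 1 then X else Y) =
      (S.length - (S.map fun p : ℕ ↦ (1 / p : ℝ)).sum) * X := fun X Y ↦ by
    rw [← sum_map_one_sub, ← List.sum_toFinset _ (hPn.filter _)]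
    exact sum_congr rfl fun p hp ↦ by rw [if_pos (hSd p (List.mem_toFinset.1 hp))]
  have hsumR : ∀ X Y : ℝ, ∑ ℓ ∈ R.toFinset, (1 - 1 / ℓ : ℝ) * (if ℓ ∣ q + 1 then X else Y) =
      (R.length - (R.map fun p : ℕ ↦ (1 / p : ℝ)).sum) * Y := fun X Y ↦ by
    rw [← sum_map_one_sub, ← List.sum_toFinset _ (hMn.filter _)]
    exact sum_congr rfl fun p hp ↦ by rw [if_neg (hRd p (List.mem_toFinset.1 hp))]
  have hinv : ∑ ℓ ∈ S.toFinset ∪ R.toFinset, (1 / ℓ : ℝ) =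
      (S.map fun p : ℕ ↦ (1 / p : ℝ)).sum + (R.map fun p : ℕ ↦ (1 / p : ℝ)).sum := by
    rw [sum_union hSR, List.sum_toFinset _ (hPn.filter _), List.sum_toFinset _ (hMn.filter _)]
  obtain ⟨T, hT⟩ : ∃ T : ℝ, T = (if q % 4 = 3 then 4 else 2) * 2 ^ c.length := ⟨_, rfl⟩
  obtain ⟨V, hV⟩ : ∃ V : ℝ, V = 4 * 2 ^ (c.length + e.length) := ⟨_, rfl⟩
  obtain ⟨h1, h2⟩ := sieveInequality_spec h
    (fun p hp ↦ ((hPm p).1 (List.mem_of_mem_filter hp)).1.1.pos)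
    (fun p hp ↦ ((hMm p).1 (List.mem_of_mem_filter hp)).1.1.pos) hT hV rfl rfl
  refine ⟨c.toFinset ∪ e.toFinset, S.toFinset ∪ R.toFinset, ?_, ?_, T, V, by rw [hT, hcF],
    by rw [hV, hceC], hinv.trans_le h1, ?_⟩
  · ext p
    have hsplit : ∀ l : List ℕ, (p ∈ l.filter fun p ↦ p.ble b) ∨ (p ∈ l.filter fun p ↦ b.blt p) ↔
        p ∈ l := fun l ↦ by
      rw [List.mem_filter, List.mem_filter, ← and_or_left, hb p]
      exact and_iff_left (em' _)
    rw [mem_union, mem_union, mem_union, or_or_or_comm]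
    simp only [List.mem_toFinset]
    rw [hc, hS, he, hR, hsplit, hsplit, hPm, hMm, mem_erase, Nat.mem_primeFactors, ← and_or_left,
      hsub]
    constructor
    · rintro ⟨⟨h3, h4⟩, h5⟩
      exact ⟨h4, h3, h3.dvd_mul.2 h5, hq2⟩
    · rintro ⟨h4, h3, h5, -⟩
      exact ⟨⟨h3, h4⟩, h3.dvd_mul.1 h5⟩
  · rw [disjoint_left]
    intro p hp1 hp2
    simp only [mem_union, List.mem_toFinset, hc, he, hS, hR, List.mem_filter, hb] at hp1 hp2
    tauto
  · rw [sum_union hSR, hsumS, hsumR, hinv]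
    exact h2

/-- The numbers `2 * (100 * i + j) + 3` are the odd numbers from `3` to `15001`; the nested ranges
keep the recursion shallow. -/
theorem smallTest_eq_true : ∀ i < 75, ∀ j < 100, smallTest (2 * (100 * i + j) + 3) = true := by
  decide +kernel

theorem sieveCriterion_of_lt {q : ℕ} (hq : IsPrimePow q) (hodd : Odd q)
    (hexc : q ∉ exceptionalOrders) (hlt : q < 15003) : SieveCriterion q := by
  obtain ⟨k, hk⟩ := hodd
  have hq1 := hq.one_lt
  have h := smallTest_eq_true ((k - 1) / 100) (by omega) ((k - 1) % 100) (by omega)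
  rw [Nat.div_add_mod, show 2 * (k - 1) + 3 = q by omega] at h
  unfold smallTest at h
  rw [Bool.or_eq_true, Bool.or_eq_true, Bool.or_eq_true, Nat.ble_eq, decide_eq_true_iff] at h
  rcases h with h | h | h | h
  · exact sieveCriterion_of_sieveTest hq1 h
  · exact sieveCriterion_of_sieveTest hq1 h
  · have h1 : (trialFactors q 2 q).toFinset = q.primeFactors := by
      ext p
      rw [List.mem_toFinset, mem_trialFactors_two (by omega), Nat.mem_primeFactors]
      exact ⟨fun h ↦ ⟨h.1, h.2, by omega⟩, fun h ↦ ⟨h.1, h.2.1⟩⟩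
    have h2 := isPrimePow_iff_card_primeFactors_eq_one.1 hq
    rw [← h1, List.toFinset_card_of_nodup (nodup_trialFactors_two (by omega))] at h2
    omega
  · exact absurd h hexc

end SmallFields

/-! ### The criterion for large `q` -/

section LargeFields

open Finset

/-- A form of the criterion with a single bound `V * √q` for all error terms. -/
theorem sieveCriterion_of_mul_lt {q : ℕ} (hq : 0 < q) {C R : Finset ℕ}
    (hCR : C ∪ R = (q ^ 2 - 1).primeFactors.erase 2) (hdisj : Disjoint C R) {δ : ℝ} (hδ : 0 ≤ δ)
    (hδR : δ = 1 - ∑ ℓ ∈ R, (1 / ℓ : ℝ))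
    (h : 4 * 2 ^ #C * (#R - 1 + 2 * δ) < δ * √q) : SieveCriterion q := by
  obtain ⟨T, hT⟩ : ∃ T : ℝ, T = (if q % 4 = 3 then 4 else 2) * 2 ^ #{ℓ ∈ C | ℓ ∣ q + 1} := ⟨_, rfl⟩
  obtain ⟨V, hV⟩ : ∃ V : ℝ, V = 4 * 2 ^ #C := ⟨_, rfl⟩
  have hT0 : 0 ≤ T := by rw [hT]; split_ifs <;> positivity
  have hx : 1 ≤ √(q : ℝ) := by
    rw [Real.one_le_sqrt]; exact_mod_cast hq
  have hx2 : √(q : ℝ) * √q = q := Real.mul_self_sqrt (Nat.cast_nonneg q)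
  have hTx : T ≤ T * √q := le_mul_of_one_le_right hT0 hx
  refine ⟨C, R, hCR, hdisj, T, V, hT, hV, by linarith, ?_⟩
  rw [← hV] at h
  rw [← hδR]
  have h1 : ∑ ℓ ∈ R, (1 - 1 / ℓ : ℝ) * (if ℓ ∣ q + 1 then T + (V - T) * √q else V * √q) ≤
      ∑ ℓ ∈ R, (1 - 1 / ℓ : ℝ) * (V * √q) := by
    refine sum_le_sum fun ℓ hℓ ↦ mul_le_mul_of_nonneg_left ?_ ?_
    · split_ifs <;> linarith
    · have hm : ℓ ∈ (q ^ 2 - 1).primeFactors.erase 2 := hCR ▸ mem_union_right C hℓ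
      have : (1 : ℝ) ≤ ℓ := by
        exact_mod_cast (Nat.prime_of_mem_primeFactors (mem_of_mem_erase hm)).one_le
      rw [sub_nonneg, div_le_one (by linarith)]
      exact this
  have h2 : ∑ ℓ ∈ R, (1 - 1 / ℓ : ℝ) * (V * √q) = (#R - (1 - δ)) * (V * √q) := by
    rw [← sum_mul, sum_sub_distrib, hδR]; simp
  have h3 : δ * (q - V * √q) ≤ δ * (q - (T - 1 + (V - T) * √q)) :=
    mul_le_mul_of_nonneg_left (by linarith) hδ
  have h4 := mul_lt_mul_of_pos_right h (by linarith : 0 < √(q : ℝ))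
  rw [mul_assoc δ, hx2] at h4
  linarith

/-- The elements of a set of primes are at least as large as the consecutive primes: this bounds
the next prime after `R`. -/
theorem nth_prime_card_add_le (k : ℕ) (R : Finset ℕ)
    (hR : ∀ ℓ ∈ R, ℓ.Prime ∧ Nat.nth Nat.Prime k ≤ ℓ) :
    ∀ a : ℕ, a.Prime → Nat.nth Nat.Prime k ≤ a → (∀ ℓ ∈ R, ℓ < a) →
      Nat.nth Nat.Prime (#R + k) ≤ a := by
  induction R using Finset.induction_on_max with
  | empty => simp
  | insert b R hb ih =>
    intro a ha hka hRa
    have hbR := hR b (mem_insert_self b R)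
    have h1 := ih (fun ℓ hℓ ↦ hR ℓ (mem_insert_of_mem hℓ)) b hbR.1 hbR.2 hb
    have h2 := h1.trans_lt (hRa b (mem_insert_self b R))
    rw [card_insert_of_notMem fun h ↦ (hb b h).false]
    have h3 := Nat.nth_count ha
    rw [← h3] at h2 ⊢
    rw [Nat.nth_lt_nth Nat.infinite_setOfPred_prime] at h2
    rw [Nat.nth_le_nth Nat.infinite_setOfPred_prime]
    omega

theorem sum_inv_primes_le (k : ℕ) (R : Finset ℕ)
    (hR : ∀ ℓ ∈ R, ℓ.Prime ∧ Nat.nth Nat.Prime k ≤ ℓ) :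
    ∑ ℓ ∈ R, (1 / ℓ : ℝ) ≤ ∑ i ∈ range #R, (1 / Nat.nth Nat.Prime (i + k) : ℝ) := by
  induction R using Finset.induction_on_max with
  | empty => simp
  | insert b R hb ih =>
    have hbR := hR b (mem_insert_self b R)
    have hR' := fun ℓ (hℓ : ℓ ∈ R) ↦ hR ℓ (mem_insert_of_mem hℓ)
    have h1 := nth_prime_card_add_le k R hR' b hbR.1 hbR.2 hb
    have hbn : b ∉ R := fun h ↦ (hb b h).false
    rw [sum_insert hbn, card_insert_of_notMem hbn, sum_range_succ, add_comm]
    refine add_le_add (ih hR') (one_div_le_one_div_of_le ?_ (by exact_mod_cast h1))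
    exact_mod_cast (Nat.prime_nth_prime _).pos

theorem prod_nth_prime_le (k : ℕ) (R : Finset ℕ)
    (hR : ∀ ℓ ∈ R, ℓ.Prime ∧ Nat.nth Nat.Prime k ≤ ℓ) :
    ∏ i ∈ range #R, Nat.nth Nat.Prime (i + k) ≤ ∏ ℓ ∈ R, ℓ := by
  induction R using Finset.induction_on_max with
  | empty => simp
  | insert b R hb ih =>
    have hbR := hR b (mem_insert_self b R)
    have hR' := fun ℓ (hℓ : ℓ ∈ R) ↦ hR ℓ (mem_insert_of_mem hℓ)
    have h1 := nth_prime_card_add_le k R hR' b hbR.1 hbR.2 hb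
    have hbn : b ∉ R := fun h ↦ (hb b h).false
    rw [prod_insert hbn, card_insert_of_notMem hbn, prod_range_succ, mul_comm]
    exact Nat.mul_le_mul h1 (ih hR')

theorem nth_prime_values : Nat.nth Nat.Prime 5 = 13 ∧ Nat.nth Nat.Prime 6 = 17 ∧
    Nat.nth Nat.Prime 7 = 19 ∧ Nat.nth Nat.Prime 8 = 23 ∧ Nat.nth Nat.Prime 9 = 29 ∧
    Nat.nth Nat.Prime 10 = 31 ∧ Nat.nth Nat.Prime 11 = 37 ∧ Nat.nth Nat.Prime 12 = 41 ∧
    Nat.nth Nat.Prime 13 = 43 ∧ Nat.nth Nat.Prime 14 = 47 ∧ Nat.nth Nat.Prime 15 = 53 ∧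
    Nat.nth Nat.Prime 16 = 59 := by
  have key : ∀ m n : ℕ, n.Prime → Nat.count Nat.Prime n = m → Nat.nth Nat.Prime m = n :=
    fun m n h1 h2 ↦ h2 ▸ Nat.nth_count h1
  refine ⟨?_, ?_, ?_, ?_, ?_, ?_, ?_, ?_, ?_, ?_, ?_, ?_⟩ <;>
    exact key _ _ (by norm_num) (by decide +kernel)

/-- The product of the first `t` odd primes reaches `32 * 16 ^ t` at `t = 16`, and every later prime
exceeds `16`. -/
theorem mul_sixteen_pow_le_prod {t : ℕ} (ht : 16 ≤ t) :
    32 * 16 ^ t ≤ ∏ i ∈ range t, Nat.nth Nat.Prime (i + 1) := by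
  induction t, ht using Nat.le_induction with
  | base =>
    obtain ⟨h5, h6, h7, h8, h9, h10, h11, h12, h13, h14, h15, h16⟩ := nth_prime_values
    simp only [prod_range_succ, range_zero, prod_empty, Nat.reduceAdd, h5, h6, h7, h8, h9, h10,
      h11, h12, h13, h14, h15, h16, Nat.nth_prime_one_eq_three, Nat.nth_prime_two_eq_five,
      Nat.nth_prime_three_eq_seven, Nat.nth_prime_four_eq_eleven]
    norm_num
  | succ t ht ih =>
    have h1 := Nat.add_two_le_nth_prime (t + 1)
    rw [prod_range_succ, pow_succ, ← mul_assoc]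
    exact Nat.mul_le_mul ih (by omega)

/-- As `8 ∣ q ^ 2 - 1`, the odd primes dividing `q ^ 2 - 1` have product less than `q ^ 2 / 8`. -/
theorem eight_mul_prod_lt_sq {q : ℕ} (hodd : Odd q) (hq : 1 < q) :
    8 * ∏ ℓ ∈ (q ^ 2 - 1).primeFactors.erase 2, ℓ < q ^ 2 := by
  have hq2 : 1 < q ^ 2 := Nat.one_lt_pow (by omega) hq
  have h8 : 8 ∣ q ^ 2 - 1 := Nat.eight_dvd_sq_sub_one_of_odd hodd
  have hprod : ∏ ℓ ∈ (q ^ 2 - 1).primeFactors.erase 2, ℓ ∣ q ^ 2 - 1 :=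
    (prod_dvd_prod_of_subset _ _ _ (erase_subset _ _)).trans (Nat.prod_primeFactors_dvd _)
  have hcop : Nat.Coprime 8 (∏ ℓ ∈ (q ^ 2 - 1).primeFactors.erase 2, ℓ) := by
    refine Nat.Coprime.prod_right fun ℓ hℓ ↦ Nat.Coprime.pow_left (m := 2) 3 ?_
    rw [mem_erase] at hℓ
    exact (Nat.coprime_primes Nat.prime_two (Nat.prime_of_mem_primeFactors hℓ.2)).2 hℓ.1.symm
  have := Nat.le_of_dvd (by omega) (hcop.mul_dvd_of_dvd_of_dvd h8 hprod)
  omega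

/-- With the smallest odd prime kept and the others sieved, the criterion follows from an
inequality between a lower bound `r` for `√q` and the reciprocals of the first primes from `5` on.
The constants `8` and `16` are `V` for one kept prime and `2 * V`. -/
theorem sieveCriterion_of_card {q : ℕ} (hq : 0 < q) {t : ℕ}
    (ht : #((q ^ 2 - 1).primeFactors.erase 2) = t + 1) {r : ℕ} (hr : r ^ 2 ≤ q)
    (hδ : ∑ i ∈ range t, (1 / Nat.nth Nat.Prime (i + 2) : ℝ) ≤ 1) (hr16 : 16 ≤ r)
    (h : 8 * (t - 1 : ℝ) <
      (1 - ∑ i ∈ range t, (1 / Nat.nth Nat.Prime (i + 2) : ℝ)) * (r - 16)) :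
    SieveCriterion q := by
  set A := (q ^ 2 - 1).primeFactors.erase 2 with hA
  have hne : A.Nonempty := card_pos.1 (by omega)
  have hAp : ∀ ℓ ∈ A, ℓ.Prime ∧ 3 ≤ ℓ := fun ℓ hℓ ↦ by
    rw [hA, mem_erase] at hℓ
    have h1 := Nat.prime_of_mem_primeFactors hℓ.2
    exact ⟨h1, by have := h1.two_le; omega⟩
  have hmin := A.min'_mem hne
  have hcard : #(A.erase (A.min' hne)) = t := by
    rw [card_erase_of_mem hmin]; omega
  have hsum := sum_inv_primes_le 2 (A.erase (A.min' hne)) fun ℓ hℓ ↦ by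
    have h1 := hAp _ (mem_of_mem_erase hℓ)
    have h2 := A.min'_lt_of_mem_erase_min' hne hℓ
    have h3 := (hAp _ hmin).2
    have h4 : ℓ ≠ 4 := by rintro rfl; exact absurd h1.1 (by norm_num)
    rw [Nat.nth_prime_two_eq_five]
    exact ⟨h1.1, by omega⟩
  rw [hcard] at hsum
  have hrq : (r : ℝ) ≤ √q := Real.le_sqrt_of_sq_le (by exact_mod_cast hr)
  have hr16' : (16 : ℝ) ≤ r := by exact_mod_cast hr16
  refine sieveCriterion_of_mul_lt hq (C := {A.min' hne}) (R := A.erase (A.min' hne)) ?_ ?_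
    (δ := 1 - ∑ ℓ ∈ A.erase (A.min' hne), (1 / ℓ : ℝ)) (by linarith) rfl ?_
  · rw [← insert_eq, insert_erase hmin]
  · simp
  · rw [hcard, card_singleton]
    have h1 := mul_le_mul (sub_le_sub_left hsum 1) (sub_le_sub_right hrq 16) (by linarith)
      (by linarith)
    linarith

theorem sieveCriterion_of_le {q : ℕ} (hodd : Odd q) (hq : 15003 ≤ q) : SieveCriterion q := by
  obtain ⟨t, ht⟩ : ∃ t, #((q ^ 2 - 1).primeFactors.erase 2) = t := ⟨_, rfl⟩
  have hprod := (Nat.mul_le_mul_left 8 (prod_nth_prime_le 1 ((q ^ 2 - 1).primeFactors.erase 2)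
    fun ℓ hℓ ↦ by
      rw [mem_erase] at hℓ
      have h1 := Nat.prime_of_mem_primeFactors hℓ.2
      rw [Nat.nth_prime_one_eq_three]
      exact ⟨h1, by have := h1.two_le; omega⟩)).trans_lt (eight_mul_prod_lt_sq hodd (by omega))
  rw [ht] at hprod
  have hfull : 4 * 2 ^ t < √(q : ℝ) → SieveCriterion q := fun h ↦ by
    refine sieveCriterion_of_mul_lt (by omega) (R := ∅) (δ := 1) (union_empty _)
      (disjoint_empty_right _) (by norm_num) (by simp) ?_
    rw [ht]
    norm_num
    linarith
  rcases Nat.lt_or_ge t 5 with ht5 | ht5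
  · refine hfull (lt_of_le_of_lt (b := (64 : ℝ)) ?_ (Real.lt_sqrt_of_sq_lt ?_))
    · have : (2 : ℝ) ^ t ≤ 2 ^ 4 := pow_le_pow_right₀ (by norm_num) (by omega)
      linarith
    · have : (15003 : ℝ) ≤ q := by exact_mod_cast hq
      linarith
  rcases Nat.lt_or_ge t 16 with ht16 | ht16
  · obtain ⟨h5, h6, h7, h8, h9, h10, h11, h12, h13, h14, h15, -⟩ := nth_prime_values
    have hsq : ∀ r : ℕ, r ^ 4 ≤ 8 * ∏ i ∈ range t, Nat.nth Nat.Prime (i + 1) → r ^ 2 ≤ q :=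
      fun r h ↦ by
        have : (r ^ 2) ^ 2 < q ^ 2 := by rw [← pow_mul]; exact h.trans_lt hprod
        exact (lt_of_pow_lt_pow_left₀ 2 (by omega) this).le
    -- For `t ≤ 7` the lower bound for `√q` is that of `q ≥ 15003`; for `t ≥ 8` it comes
    -- from the product of the first `t` odd primes.
    obtain ⟨r, hr, hrt⟩ : ∃ r : ℕ, r ^ 2 ≤ q ∧ (t = 5 ∧ r = 122 ∨ t = 6 ∧ r = 122 ∨
        t = 7 ∧ r = 122 ∨ t = 8 ∧ r = 172 ∨ t = 9 ∧ r = 220 ∨ t = 10 ∧ r = 300 ∨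
        t = 11 ∧ r = 400 ∨ t = 12 ∧ r = 500 ∨ t = 13 ∧ r = 600 ∨ t = 14 ∧ r = 700 ∨
        t = 15 ∧ r = 800) := by
      interval_cases t
      · exact ⟨122, by omega, by simp⟩
      · exact ⟨122, by omega, by simp⟩
      · exact ⟨122, by omega, by simp⟩
      all_goals
        simp only [prod_range_succ, range_zero, prod_empty, Nat.reduceAdd, h5, h6, h7, h8, h9, h10,
          h11, h12, h13, h14, h15, Nat.nth_prime_one_eq_three, Nat.nth_prime_two_eq_five,
          Nat.nth_prime_three_eq_seven, Nat.nth_prime_four_eq_eleven] at hsq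
      · exact ⟨172, hsq _ (by norm_num), by simp⟩
      · exact ⟨220, hsq _ (by norm_num), by simp⟩
      · exact ⟨300, hsq _ (by norm_num), by simp⟩
      · exact ⟨400, hsq _ (by norm_num), by simp⟩
      · exact ⟨500, hsq _ (by norm_num), by simp⟩
      · exact ⟨600, hsq _ (by norm_num), by simp⟩
      · exact ⟨700, hsq _ (by norm_num), by simp⟩
      · exact ⟨800, hsq _ (by norm_num), by simp⟩
    obtain ⟨s, rfl⟩ : ∃ s, t = s + 1 := ⟨t - 1, by omega⟩
    refine sieveCriterion_of_card (by omega) ht hr ?_ (by omega) ?_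
    all_goals
      rcases hrt with ⟨h, rfl⟩ | ⟨h, rfl⟩ | ⟨h, rfl⟩ | ⟨h, rfl⟩ | ⟨h, rfl⟩ | ⟨h, rfl⟩ | ⟨h, rfl⟩ |
        ⟨h, rfl⟩ | ⟨h, rfl⟩ | ⟨h, rfl⟩ | ⟨h, rfl⟩ <;>
      obtain rfl := Nat.succ.inj h <;>
      simp only [sum_range_succ, range_zero, sum_empty, Nat.reduceAdd, h5, h6, h7, h8, h9, h10,
        h11, h12, h13, h14, h15, Nat.nth_prime_two_eq_five, Nat.nth_prime_three_eq_seven,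
        Nat.nth_prime_four_eq_eleven] <;>
      norm_num
  · -- `(4 * 2 ^ t) ^ 4 = 8 * (32 * 16 ^ t) < q ^ 2`, so the trivial choice `R = ∅` is enough.
    refine hfull (Real.lt_sqrt_of_sq_lt ?_)
    have h1 := (Nat.mul_le_mul_left 8 (mul_sixteen_pow_le_prod ht16)).trans_lt hprod
    have h2 : (4 * 2 ^ t) ^ 2 < q := by
      refine lt_of_pow_lt_pow_left₀ 2 (by omega) (lt_of_eq_of_lt ?_ h1)
      rw [show (16 : ℕ) = 2 ^ 4 by norm_num, ← pow_mul 2 4 t, mul_comm 4 t, pow_mul 2 t 4]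
      ring
    exact_mod_cast h2

end LargeFields

theorem mainTheorem5 (q : ℕ) (hq : IsPrimePow q) (hodd : Odd q) (hexc : q ∉ exceptionalOrders)
    {F E : Type*} [Field F] [Field E] [Finite F] [Finite E] [Algebra F E]
    (hF : Nat.card F = q) (hE : Nat.card E = q ^ 2) (β : F) (hβ : β ≠ 0) :
    ∃ ξ : E, IsRPrimitive 2 ξ ∧ Algebra.trace F E ξ = β := by
  have := Fintype.ofFinite F
  have := Fintype.ofFinite E
  have h : SieveCriterion q := by
    rcases Nat.lt_or_ge q 15003 with hlt | hle
    · exact sieveCriterion_of_lt hq hodd hexc hlt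
    · exact sieveCriterion_of_le hodd hle
  rw [Nat.card_eq_fintype_card] at hF hE
  exact h.exists_isRPrimitive hodd hF hE hβ
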